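/- **Setting.** Let $G=(V,E)$ be a finite directed graph with $n=|V|\ge 1$ nodes and a propagation probability $p_e\in[0,1]$ on each edge $e$. Let $S_r\subseteq V$ be the seed set of a rumor. For a seed set $S\subseteq V$ of a competing positive cascade, consider the competitive independent cascade process. At time $0$ the nodes of $S_r$ are activated by the rumor and those of $S\setminus S_r$ by the positive cascade. At each time $t\ge 1$, every node $u$ activated at time $t-1$ tries, independently, to activate each currently inactive node $v$ with $(u,v)\in E$, with success probability $p_{(u,v)}$. A node reached at the same time by both cascades is activated by the rumor, and active nodes never change state. Let $f(S)$ be the expected number of nodes that are not activated by the rumor when the process has terminated. For an integer $1\le k\le n$, let $OPT_k=\max_{|S|\le k}f(S)$. **Random R-tuples.** A random R-tuple $T=(V^*,E_t,E_f,B)$ is generated as follows. Choose $v\in V$ uniformly at random and put $V^*=E_t=E_f=\emptyset$, $V_1=\{v\}$. Then repeat: if $V_1=\emptyset$, return with $B=0$; otherwise, if $V_1\cap S_r\ne\emptyset$, return with $B=1$; otherwise replace $V^*$ by $V^*\cup V_1$ and test, independently, every edge $(u_2,u_1)\in E$ with $u_1\in V^*$, $u_2\notin V^*$ that has not been tested before.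 A test succeeds with probability $p_{(u_2,u_1)}$. Successful edges are added to $E_t$, the others to $E_f$, and the new $V_1$ is the set of the tails $u_2$ of the edges that succeeded in this round. For a list $R$ of R-tuples, let $F(S,R)$ be the number of $T\in R$ with $S\cap V^*(T)\neq\emptyset$ or $B(T)=0$. **Node selection.** Given $R$ and $k$, replace $V^*(T)$ by $V$ for each $T\in R$ with $B(T)=0$. Starting from $S'=\emptyset$, do $k$ times: add to $S'$ a node $v\in V\setminus S'$ that lies in the largest number of those sets $V^*(T)$, $T\in R$, that are disjoint from $S'$. Ties are broken by an arbitrary fixed rule. **Estimation of $OPT_k$** (parameters $\delta>0$, $N>0$). Let $\lambda_3=n(2+\delta)\ln\!\big(N\binom nk\log_2 n\big)/\delta^2$ and let $R$ be empty. For each integer $i$ with $1\le i\le\log_2(n-1)$, in increasing order: put $x_i=n/2^i$ and $l_i=\lambda_3/x_i$; add independent random R-tuples to $R$ while $|R|\le l_i$; let $S'$ be the result of node selection on $R$; if $nF(S',R)/l_i\ge(1+\delta)x_i$, stop and return $OPT_k^*=nF(S',R)/(l_i(1+\delta))$. If no iteration returns (in particular, if there is no iteration), return $OPT_k^*=1$.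 **Algorithm RBR.** Let $N>0$, $\delta_1>0$, $\delta_2>(1-1/e)\delta_1$ and $\delta_3>0$. Compute $OPT_k^*$ by the estimation procedure with $\delta=\delta_3$ and put $$l_1=\frac{2n\ln N}{\delta_1^2\,OPT_k^*},\qquad l_2=\frac{\big(2+\delta_2-(1-1/e)\delta_1\big)\,n\,\ln\!\big(N\binom nk\big)}{\big(\delta_2-(1-1/e)\delta_1\big)^2\,OPT_k^*},\qquad l^*=\max(l_1,l_2).$$ Generate $\lceil l^*\rceil$ fresh independent random R-tuples (none if $l^*\le 0$) and return the set $S^*$ obtained by node selection on them. **Theorem.** With probability at least $1-5/N$, the returned set $S^*$ has at most $k$ nodes and satisfies $$f(S^*)\ \ge\ (1-1/e-\delta_2)\cdot OPT_k .$$ -/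

import Mathlib

open scoped ENNReal

noncomputable section

namespace RumorBlocking

variable {V : Type*} [DecidableEq V]

/-- An independent cascade network: a directed graph with a propagation probability on each edge.
The values of `prob` outside `edges` are never used. -/
structure ICNetwork (V : Type*) where
  edges : Finset (V × V)
  prob : V × V → unitInterval

namespace ICNetwork

/-- Probability that independent coins, one for each edge `e ∈ A` with success probability `p_e`,
succeed exactly on the edges of `H`. -/
def coinWeight (G : ICNetwork V) (A H : Finset (V × V)) : ℝ≥0∞ :=
  if H ⊆ A then
    (∏ e ∈ H, ENNReal.ofReal (G.prob e)) * ∏ e ∈ A \ H, ENNReal.ofReal (1 - G.prob e)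
  else 0

theorem sum_coinWeight (G : ICNetwork V) (A : Finset (V × V)) :
    ∑ H ∈ A.powerset, G.coinWeight A H = 1 := by
  have h1 : ∀ e : V × V,
      ENNReal.ofReal (G.prob e) + ENNReal.ofReal (1 - G.prob e) = 1 := by
    intro e
    rw [← ENNReal.ofReal_add (G.prob e).2.1 (by linarith [(G.prob e).2.2])]
    simp
  have h2 := Finset.prod_add (fun e : V × V => ENNReal.ofReal (G.prob e))
    (fun e => ENNReal.ofReal (1 - G.prob e)) A
  simp only [h1, Finset.prod_const_one] at h2
  rw [h2]
  refine Finset.sum_congr rfl fun H hH => ?_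
  simp [coinWeight, Finset.mem_powerset.1 hH]

/-- Toss an independent coin for each edge of `A`; the outcome is the set of successful edges. -/
def tossCoins (G : ICNetwork V) (A : Finset (V × V)) : PMF (Finset (V × V)) :=
  PMF.ofFinset (G.coinWeight A) A.powerset (G.sum_coinWeight A) fun H hH => by
    simp only [Finset.mem_powerset] at hH
    simp [coinWeight, hH]

/-! ### The competitive diffusion process -/

/-- State of the diffusion after some time step: the nodes activated so far by the rumor and by the
positive cascade, and those among them that were activated in the last time step. -/
structure DiffusionState (V : Type*) where
  rumor : Finset V
  positive : Finset V
  newRumor : Finset V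
  newPositive : Finset V

/-- Time `0`: the seeds are activated; the rumor has priority on common seeds. -/
def initialState (Sr Sp : Finset V) : DiffusionState V where
  rumor := Sr
  positive := Sp \ Sr
  newRumor := Sr
  newPositive := Sp \ Sr

/-- Edges along which a node activated in the last time step tries to activate an inactive node. -/
def attempts (G : ICNetwork V) (s : DiffusionState V) : Finset (V × V) :=
  G.edges.filter fun e =>
    e.1 ∈ s.newRumor ∪ s.newPositive ∧ e.2 ∉ s.rumor ∪ s.positive

/-- The state after one more time step in which exactly the attempts in `H` succeed. A node reached
by both cascades in this step is activated by the rumor. -/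
def advance (s : DiffusionState V) (H : Finset (V × V)) : DiffusionState V :=
  let r := (H.filter fun e => e.1 ∈ s.newRumor).image Prod.snd
  let q := (H.filter fun e => e.1 ∈ s.newPositive).image Prod.snd \ r
  { rumor := s.rumor ∪ r
    positive := s.positive ∪ q
    newRumor := r
    newPositive := q }

/-- Run the stochastic diffusion process for a given number of time steps. -/
def diffuse (G : ICNetwork V) : ℕ → DiffusionState V → PMF (DiffusionState V)
  | 0, s => PMF.pure s
  | t + 1, s => (G.tossCoins (G.attempts s)).bind fun H => G.diffuse t (advance s H)

variable [Fintype V]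

/-- Law of the set of nodes that are finally activated by the rumor. Every time step before
termination activates a new node and later steps change nothing, so that the process has terminated
after `|V|` steps. -/
def rumorLaw (G : ICNetwork V) (Sr Sp : Finset V) : PMF (Finset V) :=
  (G.diffuse (Fintype.card V) (initialState Sr Sp)).map DiffusionState.rumor

/-- The objective `f(S_p)`: expected number of nodes that are not activated by the rumor. -/
def objective (G : ICNetwork V) (Sr Sp : Finset V) : ℝ :=
  ∑ A : Finset V, (G.rumorLaw Sr Sp A).toReal * ((Aᶜ).card : ℝ)

/-- `OPT_k`, the maximum of `f(S)` over the node sets `S` with at most `k` nodes. -/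
def opt (G : ICNetwork V) (Sr : Finset V) (k : ℕ) : ℝ :=
  ((Finset.univ : Finset (Finset V)).filter fun S => S.card ≤ k).sup'
    ⟨∅, by simp⟩ (G.objective Sr)

end ICNetwork

/-! ### Random R-tuples -/

variable [Fintype V]

/-- A reverse tuple `(V^*, E_t, E_f, B)`. -/
structure RTuple (V : Type*) where
  nodes : Finset V
  edgesTrue : Finset (V × V)
  edgesFalse : Finset (V × V)
  hitRumor : Bool

namespace ICNetwork

/-- The loop of the reverse breadth-first search; `front` is the set `V_1`. In each round the edges
from outside into the enlarged `V^*` that have not been tested yet are tested. The first argument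
bounds the number of rounds. -/
def rTupleLoop (G : ICNetwork V) (Sr : Finset V) :
    ℕ → (nodes : Finset V) → (Et Ef : Finset (V × V)) → (front : Finset V) → PMF (RTuple V)
  | 0, nodes, Et, Ef, _ => PMF.pure ⟨nodes, Et, Ef, false⟩
  | t + 1, nodes, Et, Ef, front =>
    if front = ∅ then PMF.pure ⟨nodes, Et, Ef, false⟩
    else if front ∩ Sr ≠ ∅ then PMF.pure ⟨nodes, Et, Ef, true⟩
    else
      let nodes' := nodes ∪ front
      let A := G.edges.filter fun e => e.2 ∈ nodes' ∧ e.1 ∉ nodes' ∧ e ∉ Et ∪ Ef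
      (G.tossCoins A).bind fun H =>
        G.rTupleLoop Sr t nodes' (Et ∪ H) (Ef ∪ (A \ H)) (H.image Prod.fst)

/-- The random R-tuple of `v`. Each round but the last enlarges `V^*`, so that the search always
returns within `|V| + 1` rounds. -/
def rTupleOf (G : ICNetwork V) (Sr : Finset V) (v : V) : PMF (RTuple V) :=
  G.rTupleLoop Sr (Fintype.card V + 1) ∅ ∅ ∅ {v}

/-- The random R-tuple: that of a uniformly random node. -/
def rTuple [Nonempty V] (G : ICNetwork V) (Sr : Finset V) : PMF (RTuple V) :=
  (PMF.uniformOfFintype V).bind fun v => G.rTupleOf Sr v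

/-- A list of `l` independent random R-tuples. -/
def rTuples [Nonempty V] (G : ICNetwork V) (Sr : Finset V) : ℕ → PMF (List (RTuple V))
  | 0 => PMF.pure []
  | l + 1 => (G.rTuple Sr).bind fun T => (G.rTuples Sr l).map fun R => T :: R

end ICNetwork

/-- `F(S, R)`, the number of tuples `T` in `R` with `x(S, T) = 1`, that is, `S` meets `V^*` or
`B = 0`. -/
def coverage (S : Finset V) (R : List (RTuple V)) : ℕ :=
  R.countP fun T => decide (S ∩ T.nodes ≠ ∅ ∨ T.hitRumor = false)

/-! ### Greedy node selection -/

/-- The node set of a tuple as used by the node selection: all of `V` if `B = 0`. -/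
def RTuple.coverSet (T : RTuple V) : Finset V :=
  if T.hitRumor then T.nodes else Finset.univ

/-- The number of tuples of `R` not yet covered by `S` that `v` covers. -/
def gain (R : List (RTuple V)) (S : Finset V) (v : V) : ℕ :=
  R.countP fun T => decide (S ∩ T.coverSet = ∅ ∧ v ∈ T.coverSet)

/-- `GreedySelects R j S`: the greedy node selection on `R`, with ties broken in some way, can have
selected the set `S` after `j` rounds. In each round a further node that covers the most tuples not
yet covered is added. -/
inductive GreedySelects (R : List (RTuple V)) : ℕ → Finset V → Prop
  | zero : GreedySelects R 0 ∅
  | succ {j : ℕ} {S : Finset V} {v : V} : GreedySelects R j S → v ∉ S →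
      (∀ u, u ∉ S → gain R S u ≤ gain R S v) → GreedySelects R (j + 1) (insert v S)

/-! ### The estimation of `OPT_k` and the main algorithm -/

/-- `λ₃ = n (2 + δ) ln(N binom(n, k) log₂ n) / δ²`. -/
def lambda₃ (n k : ℕ) (δ N : ℝ) : ℝ :=
  n * (2 + δ) * Real.log (N * (n.choose k : ℝ) * Real.logb 2 n) / δ ^ 2

/-- The estimation loop, with `t` iterations left, the next one being number `i`, and the list `R`
of tuples generated so far; `lam` is `λ₃`. In an iteration tuples are added while `|R| ≤ l_i`,
that is, until `|R| ≥ ⌊l_i⌋ + 1`. If no iteration returns, the result is the a priori lower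
bound `1`. -/
def ICNetwork.estimateLoop [Nonempty V] (G : ICNetwork V) (Sr : Finset V)
    (sel : List (RTuple V) → Finset V) (δ lam : ℝ) : ℕ → (i : ℕ) → List (RTuple V) → PMF ℝ
  | 0, _, _ => PMF.pure 1
  | t + 1, i, R =>
    let n : ℝ := Fintype.card V
    let x : ℝ := n / 2 ^ i
    let l : ℝ := lam / x
    (G.rTuples Sr ((⌊l⌋ + 1).toNat - R.length)).bind fun R₀ =>
      let R' := R ++ R₀
      let F : ℝ := coverage (sel R') R'
      if n * F / l ≥ (1 + δ) * x then PMF.pure (n * F / (l * (1 + δ)))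
      else G.estimateLoop Sr sel δ lam t (i + 1) R'

/-- The random estimate `OPT_k^*`; the iterations are `1 ≤ i ≤ log₂ (n - 1)`. -/
def ICNetwork.estimate [Nonempty V] (G : ICNetwork V) (Sr : Finset V)
    (sel : List (RTuple V) → Finset V) (k : ℕ) (δ N : ℝ) : PMF ℝ :=
  G.estimateLoop Sr sel δ (lambda₃ (Fintype.card V) k δ N) (Nat.log 2 (Fintype.card V - 1)) 1 []

/-- `l₁`, with `o` the estimate of `OPT_k`. -/
def sampleSize₁ (n : ℕ) (N δ₁ o : ℝ) : ℝ :=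
  2 * n * Real.log N / (δ₁ ^ 2 * o)

/-- `l₂`, with `o` the estimate of `OPT_k`. -/
def sampleSize₂ (n k : ℕ) (N δ₁ δ₂ o : ℝ) : ℝ :=
  (2 + δ₂ - (1 - 1 / Real.exp 1) * δ₁) * n * Real.log (N * (n.choose k : ℝ)) /
    ((δ₂ - (1 - 1 / Real.exp 1) * δ₁) ^ 2 * o)

/-- Law of the output `S^*` of the R-tuple based randomized rumor blocking algorithm, where `sel` is
the node selection used: estimate `OPT_k`, generate `l^* = max(l₁, l₂)` (rounded up) fresh
independent random R-tuples, and select nodes on them. -/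
def ICNetwork.rbr [Nonempty V] (G : ICNetwork V) (Sr : Finset V)
    (sel : List (RTuple V) → Finset V) (k : ℕ) (N δ₁ δ₂ δ₃ : ℝ) : PMF (Finset V) :=
  (G.estimate Sr sel k δ₃ N).bind fun o =>
    (G.rTuples Sr
      ⌈max (sampleSize₁ (Fintype.card V) N δ₁ o) (sampleSize₂ (Fintype.card V) k N δ₁ δ₂ o)⌉₊).map
        sel

end RumorBlocking

end

/-! Toss the coins of all edges in advance and let `H` be the set of successful edges. Blocking
never changes who wins a node: on a shortest walk of the winning cascade to `v`, every node is
already won by the same cascade, since otherwise the competitor would reach `v` in time. Hence `v`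
ends up with the rumor iff its distance in `H` from `Sr` is finite and at most its distance from `S`
(`IsStateAt`, `RumorWins`). The reverse search from `v` collects exactly the nodes strictly closer
to `v` than every rumor seed, and `B = 0` means that no rumor seed reaches `v`. So `S` covers the
tuple iff `v` escapes the rumor (`covers_rTupleWith_iff`), and averaging over the root gives f(S) =
n · P(S covers T) (`objective_eq`).

Now F(S, R) is a sum of independent Bernoulli variables with mean |R| f(S)/n. Greedy selection loses
at most the factor 1 - 1/e against any set of at most k nodes (`GreedySelects.coverage_ge`). A lower
Chernoff bound for one optimal set, and an upper one for all `k`-sets together (the selected set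
depends on the sample), transfer this from F to f. The sample sizes decrease in the estimate, so
they suffice as soon as 0 < OPT* ≤ OPT.

The failure budget is 5/N: 1/N for each of the two tails (`select_fail_le`) and 3/N for an
overestimated optimum (`estimate_bad_le`). The 3 is the price of the one tuple that the estimation
may draw beyond l_i. If N ≤ 5 there is nothing to prove; if every node is a rumor seed then f = 0;
otherwise OPT ≥ 1, which makes the default estimate 1 admissible. -/

open scoped ENNReal

namespace RumorBlocking

/-! ### Expectations of discrete distributions -/

section Expect

variable {α β : Type*}

/-- Expectation of a nonnegative function under a discrete distribution. -/
noncomputable def expect (p : PMF α) (g : α → ℝ≥0∞) : ℝ≥0∞ := ∑' a, p a * g a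

theorem expect_pure (a : α) (g : α → ℝ≥0∞) : expect (PMF.pure a) g = g a := by
  rw [expect, tsum_eq_single a]
  · simp
  · intro b hb
    simp [PMF.pure_apply, hb]

theorem expect_bind (p : PMF α) (f : α → PMF β) (g : β → ℝ≥0∞) :
    expect (p.bind f) g = expect p fun a => expect (f a) g := by
  simp only [expect, PMF.bind_apply, ← ENNReal.tsum_mul_right, ← ENNReal.tsum_mul_left]
  rw [ENNReal.tsum_comm]
  simp only [mul_assoc]

theorem expect_map (p : PMF α) (f : α → β) (g : β → ℝ≥0∞) :
    expect (p.map f) g = expect p fun a => g (f a) := by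
  rw [← PMF.bind_pure_comp, expect_bind]
  simp [expect_pure]

theorem expect_const (p : PMF α) (c : ℝ≥0∞) : expect p (fun _ => c) = c := by
  simp [expect, ENNReal.tsum_mul_right]

theorem expect_mono (p : PMF α) {g h : α → ℝ≥0∞} (hgh : ∀ a ∈ p.support, g a ≤ h a) :
    expect p g ≤ expect p h := by
  refine ENNReal.tsum_le_tsum fun a => ?_
  by_cases ha : p a = 0
  · simp [ha]
  · exact mul_le_mul_right (hgh a ((p.mem_support_iff a).2 ha)) _

theorem expect_add (p : PMF α) (g h : α → ℝ≥0∞) :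
    expect p (fun a => g a + h a) = expect p g + expect p h := by
  simp only [expect, mul_add, ENNReal.tsum_add]

theorem expect_mul_right (p : PMF α) (g : α → ℝ≥0∞) (c : ℝ≥0∞) :
    expect p (fun a => g a * c) = expect p g * c := by
  simp only [expect, ← mul_assoc, ENNReal.tsum_mul_right]

theorem toOuterMeasure_eq_expect (p : PMF α) (s : Set α) :
    p.toOuterMeasure s = expect p (s.indicator fun _ => 1) := by
  rw [PMF.toOuterMeasure_apply, expect]
  refine tsum_congr fun a => ?_
  by_cases ha : a ∈ s <;> simp [ha]

theorem toOuterMeasure_mono_support (p : PMF α) {s t : Set α}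
    (h : ∀ a ∈ p.support, a ∈ s → a ∈ t) : p.toOuterMeasure s ≤ p.toOuterMeasure t := by
  rw [toOuterMeasure_eq_expect, toOuterMeasure_eq_expect]
  refine expect_mono p fun a ha => ?_
  by_cases hs : a ∈ s
  · simp [hs, h a ha hs]
  · simp [hs]

theorem toOuterMeasure_congr_support (p : PMF α) {s t : Set α}
    (h : ∀ a ∈ p.support, (a ∈ s ↔ a ∈ t)) : p.toOuterMeasure s = p.toOuterMeasure t :=
  le_antisymm (toOuterMeasure_mono_support p fun a ha => (h a ha).1)
    (toOuterMeasure_mono_support p fun a ha => (h a ha).2)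

theorem toOuterMeasure_le_one (p : PMF α) (s : Set α) : p.toOuterMeasure s ≤ 1 := by
  rw [toOuterMeasure_eq_expect]
  refine (expect_mono p fun a _ => ?_).trans (expect_const p 1).le
  exact Set.indicator_le_self' (fun _ _ => zero_le) a

theorem toOuterMeasure_add_compl (p : PMF α) (s : Set α) :
    p.toOuterMeasure s + p.toOuterMeasure sᶜ = 1 := by
  rw [toOuterMeasure_eq_expect, toOuterMeasure_eq_expect, ← expect_add]
  refine Eq.trans ?_ (expect_const p 1)
  congr 1
  funext a
  by_cases ha : a ∈ s <;> simp [ha]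

theorem bind_toOuterMeasure (p : PMF α) (f : α → PMF β) (s : Set β) :
    (p.bind f).toOuterMeasure s = expect p fun a => (f a).toOuterMeasure s := by
  simp only [toOuterMeasure_eq_expect, expect_bind]

/-- If an event has probability at most `c` after every good first stage, then its probability is at
most that of a bad first stage plus `c`. -/
theorem bind_toOuterMeasure_le (p : PMF α) (f : α → PMF β) (s : Set β) (bad : Set α) (c : ℝ≥0∞)
    (h : ∀ a ∉ bad, (f a).toOuterMeasure s ≤ c) :
    (p.bind f).toOuterMeasure s ≤ p.toOuterMeasure bad + c := by
  rw [bind_toOuterMeasure, toOuterMeasure_eq_expect p, ← expect_const p c, ← expect_add]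
  refine expect_mono p fun a _ => ?_
  by_cases ha : a ∈ bad
  · simp only [ha, Set.indicator_of_mem]
    exact (toOuterMeasure_le_one _ _).trans le_self_add
  · simpa [ha] using h a ha

theorem toOuterMeasure_exists_le {ι : Type*} (p : PMF α) (s : Finset ι) (Q : ι → Set α)
    (c : ℝ≥0∞) (h : ∀ i ∈ s, p.toOuterMeasure (Q i) ≤ c) :
    p.toOuterMeasure {a | ∃ i ∈ s, a ∈ Q i} ≤ s.card * c := by
  have hset : {a | ∃ i ∈ s, a ∈ Q i} = ⋃ i ∈ s, Q i := by
    ext a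
    simp
  rw [hset]
  refine (MeasureTheory.measure_biUnion_finset_le s Q).trans ?_
  rw [← nsmul_eq_mul]
  exact Finset.sum_le_card_nsmul s _ _ h

theorem bind_congr_support (p : PMF α) {f g : α → PMF β} (h : ∀ a ∈ p.support, f a = g a) :
    p.bind f = p.bind g := by
  ext b
  simp only [PMF.bind_apply]
  refine tsum_congr fun a => ?_
  by_cases ha : p a = 0
  · simp [ha]
  · rw [h a ((p.mem_support_iff a).2 ha)]

end Expect

/-! ### Tossing the coins of a network in advance -/

namespace ICNetwork

variable {V : Type*} [DecidableEq V]

theorem tossCoins_apply (G : ICNetwork V) (A H : Finset (V × V)) :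
    G.tossCoins A H = G.coinWeight A H := rfl

theorem subset_of_mem_support_tossCoins (G : ICNetwork V) {A H : Finset (V × V)}
    (h : H ∈ (G.tossCoins A).support) : H ⊆ A := by
  by_contra hH
  exact (PMF.mem_support_iff _ _).1 h (by simp [tossCoins_apply, coinWeight, hH])

theorem coinWeight_union (G : ICNetwork V) {A B H K : Finset (V × V)} (hAB : Disjoint A B)
    (hH : H ⊆ A) (hK : K ⊆ B) :
    G.coinWeight (A ∪ B) (H ∪ K) = G.coinWeight A H * G.coinWeight B K := by
  have hd : (A ∪ B) \ (H ∪ K) = (A \ H) ∪ (B \ K) := by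
    have := Finset.disjoint_left.1 hAB
    ext e
    have h1 := @hH e
    have h2 := @hK e
    have h3 := @this e
    simp only [Finset.mem_sdiff, Finset.mem_union]
    tauto
  rw [coinWeight, coinWeight, coinWeight, if_pos (Finset.union_subset_union hH hK), if_pos hH,
    if_pos hK, hd, Finset.prod_union (hAB.mono hH hK),
    Finset.prod_union (hAB.mono Finset.sdiff_subset Finset.sdiff_subset)]
  ring

theorem tossCoins_bind_tossCoins_sdiff (G : ICNetwork V) {A U : Finset (V × V)} (hA : A ⊆ U) :
    ((G.tossCoins A).bind fun H => (G.tossCoins (U \ A)).map fun K => H ∪ K) = G.tossCoins U := by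
  -- `H ∪ K` determines both `H` and `K`, so a single term of the double sum produces a given
  -- outcome `L`.
  have key : ∀ H ⊆ A, ∀ K ⊆ U \ A, (H ∪ K) ∩ A = H ∧ (H ∪ K) \ A = K := by
    intro H hH K hK
    constructor <;> ext e <;> have h1 := @hH e <;> have h2 := @hK e <;>
      simp only [Finset.mem_sdiff, Finset.mem_union, Finset.mem_inter] at * <;> tauto
  ext L
  simp only [PMF.bind_apply, PMF.map_apply]
  by_cases hL : L ⊆ U
  · have hsplit : L ∩ A ∪ L \ A = L := by rw [Finset.union_comm, Finset.sdiff_union_inter]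
    rw [tsum_eq_single (L ∩ A), tsum_eq_single (L \ A), if_pos hsplit.symm]
    · rw [tossCoins_apply, tossCoins_apply, tossCoins_apply,
        ← coinWeight_union G Finset.disjoint_sdiff Finset.inter_subset_right
          (Finset.sdiff_subset_sdiff hL subset_rfl), hsplit, Finset.union_sdiff_of_subset hA]
    · intro K hK
      by_cases hKU : K ⊆ U \ A
      · rw [if_neg]
        intro h
        exact hK (by rw [h, (key _ Finset.inter_subset_right K hKU).2])
      · simp [tossCoins_apply, coinWeight, hKU]
    · intro H hH
      by_cases hHA : H ⊆ A
      · refine mul_eq_zero.2 (Or.inr (ENNReal.tsum_eq_zero.2 fun K => ?_))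
        by_cases hKU : K ⊆ U \ A
        · rw [if_neg]
          intro h
          exact hH (by rw [h, (key H hHA K hKU).1])
        · simp [tossCoins_apply, coinWeight, hKU]
      · simp [tossCoins_apply, coinWeight, hHA]
  · rw [tossCoins_apply, coinWeight, if_neg hL]
    refine ENNReal.tsum_eq_zero.2 fun H => ?_
    by_cases hHA : H ⊆ A
    · refine mul_eq_zero.2 (Or.inr (ENNReal.tsum_eq_zero.2 fun K => ?_))
      by_cases hKU : K ⊆ U \ A
      · rw [if_neg]
        rintro rfl
        exact hL (Finset.union_subset (hHA.trans hA) (hKU.trans Finset.sdiff_subset))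
      · simp [tossCoins_apply, coinWeight, hKU]
    · simp [tossCoins_apply, coinWeight, hHA]

/-- Tossing the coins of `A` now and those of `U \ A` later amounts to tossing all of them in
advance. -/
theorem tossCoins_bind_map_eq {α : Type*} (G : ICNetwork V) {A U : Finset (V × V)} (hA : A ⊆ U)
    (f : Finset (V × V) → Finset (V × V) → α) (g : Finset (V × V) → α)
    (hfg : ∀ H ⊆ A, ∀ K ⊆ U \ A, f H K = g (H ∪ K)) :
    ((G.tossCoins A).bind fun H => (G.tossCoins (U \ A)).map (f H)) = (G.tossCoins U).map g := by
  rw [← G.tossCoins_bind_tossCoins_sdiff hA, PMF.map_bind]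
  refine bind_congr_support _ fun H hH => ?_
  rw [PMF.map_comp, ← PMF.bind_pure_comp, ← PMF.bind_pure_comp]
  refine bind_congr_support _ fun K hK => ?_
  simp [hfg H (G.subset_of_mem_support_tossCoins hH) K (G.subset_of_mem_support_tossCoins hK)]

end ICNetwork

end RumorBlocking

namespace RumorBlocking

variable {V : Type*}

/-! ### Distances in the graph of successful edges -/

/-- There is a walk with at most `t` edges, all in `H`, from `u` to `v`. -/
def Within (H : Finset (V × V)) : ℕ → V → V → Prop
  | 0, u, v => u = v
  | t + 1, u, v => ∃ w, Within H t u w ∧ (w = v ∨ (w, v) ∈ H)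

/-- The definition lengthens walks at their end, as the diffusion does; the reverse search lengthens
them at their start. -/
theorem within_succ_left {H : Finset (V × V)} {t : ℕ} {u v : V} :
    Within H (t + 1) u v ↔ ∃ w, (u = w ∨ (u, w) ∈ H) ∧ Within H t w v := by
  induction t generalizing v with
  | zero =>
    constructor
    · rintro ⟨w, hw, h⟩
      exact ⟨v, hw ▸ h, rfl⟩
    · rintro ⟨w, h, hw⟩
      exact ⟨u, rfl, hw ▸ h⟩
  | succ t ih =>
    constructor
    · rintro ⟨w, hw, h⟩
      obtain ⟨x, hx, hxw⟩ := ih.1 hw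
      exact ⟨x, hx, w, hxw, h⟩
    · rintro ⟨x, hx, w, hxw, h⟩
      exact ⟨w, ih.2 ⟨x, hx, hxw⟩, h⟩

/-- Some node of `S` is at distance at most `t` from `v`. -/
def Reaches (H : Finset (V × V)) (S : Finset V) (t : ℕ) (v : V) : Prop :=
  ∃ u ∈ S, Within H t u v

theorem reaches_zero {H : Finset (V × V)} {S : Finset V} {v : V} :
    Reaches H S 0 v ↔ v ∈ S := by
  simp [Reaches, Within]

theorem reaches_succ {H : Finset (V × V)} {S : Finset V} {t : ℕ} {v : V} :
    Reaches H S (t + 1) v ↔ ∃ w, Reaches H S t w ∧ (w = v ∨ (w, v) ∈ H) := by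
  constructor
  · rintro ⟨u, hu, w, hw, h⟩
    exact ⟨w, ⟨u, hu, hw⟩, h⟩
  · rintro ⟨w, ⟨u, hu, hw⟩, h⟩
    exact ⟨u, hu, w, hw, h⟩

theorem Within.mono {H : Finset (V × V)} {s t : ℕ} {u v : V} (hst : s ≤ t)
    (h : Within H s u v) : Within H t u v := by
  induction hst with
  | refl => exact h
  | step _ ih => exact ⟨v, ih, Or.inl rfl⟩

theorem Reaches.mono {H : Finset (V × V)} {S : Finset V} {s t : ℕ} {v : V} (hst : s ≤ t)
    (h : Reaches H S s v) : Reaches H S t v := by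
  obtain ⟨u, hu, h⟩ := h
  exact ⟨u, hu, h.mono hst⟩

/-- In the graph `H`, the rumor arrives at `v` within time `n` and not later than the positive
cascade. -/
def RumorWins (H : Finset (V × V)) (Sr Sp : Finset V) (n : ℕ) (v : V) : Prop :=
  ∃ i ≤ n, Reaches H Sr i v ∧ ∀ r < i, ¬ Reaches H Sp r v

/-- A common seed that reaches `v` is also a rumor seed, so it cannot beat the first arrival of the
rumor. -/
theorem rumorWins_sdiff [DecidableEq V] {H : Finset (V × V)} {Sr Sp : Finset V} {n : ℕ} {v : V} :
    RumorWins H Sr (Sp \ Sr) n v ↔ RumorWins H Sr Sp n v := by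
  classical
  constructor
  · rintro ⟨i, hi, hR, hP⟩
    have hex : ∃ j, Reaches H Sr j v := ⟨i, hR⟩
    have hle : Nat.find hex ≤ i := Nat.find_min' hex hR
    refine ⟨Nat.find hex, hle.trans hi, Nat.find_spec hex, ?_⟩
    rintro r hr ⟨u, hu, huv⟩
    by_cases hus : u ∈ Sr
    · exact Nat.find_min hex hr ⟨u, hus, huv⟩
    · exact hP r (hr.trans_le hle) ⟨u, Finset.mem_sdiff.2 ⟨hu, hus⟩, huv⟩
  · rintro ⟨i, hi, hR, hP⟩
    refine ⟨i, hi, hR, ?_⟩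
    rintro r hr ⟨u, hu, huv⟩
    exact hP r hr ⟨u, (Finset.mem_sdiff.1 hu).1, huv⟩

namespace ICNetwork

variable [DecidableEq V]

/-! ### The diffusion with coins tossed in advance -/

/-- The diffusion in which an attempt succeeds if its edge is in `H`. -/
def diffuseWith (G : ICNetwork V) (H : Finset (V × V)) : ℕ → DiffusionState V → DiffusionState V
  | 0, s => s
  | t + 1, s => G.diffuseWith H t (advance s (H ∩ G.attempts s))

/-- All attempts that can be made from the state `s` on are along edges of `U`. -/
structure UsesOnly (G : ICNetwork V) (s : DiffusionState V) (U : Finset (V × V)) : Prop where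
  new_subset : s.newRumor ∪ s.newPositive ⊆ s.rumor ∪ s.positive
  mem : ∀ e ∈ G.edges, (e.1 ∈ s.newRumor ∪ s.newPositive ∨ e.1 ∉ s.rumor ∪ s.positive) →
    e.2 ∉ s.rumor ∪ s.positive → e ∈ U

theorem UsesOnly.attempts_subset {G : ICNetwork V} {s : DiffusionState V} {U : Finset (V × V)}
    (h : G.UsesOnly s U) : G.attempts s ⊆ U := by
  intro e he
  obtain ⟨he, h1, h2⟩ := Finset.mem_filter.1 he
  exact h.mem e he (Or.inl h1) h2

theorem new_advance {s : DiffusionState V} {H : Finset (V × V)} {v : V}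
    (hv : v ∈ (advance s H).newRumor ∪ (advance s H).newPositive) : ∃ e ∈ H, e.2 = v := by
  simp only [advance, Finset.mem_union, Finset.mem_image, Finset.mem_filter,
    Finset.mem_sdiff] at hv
  rcases hv with ⟨e, ⟨he, _⟩, h⟩ | ⟨⟨e, ⟨he, _⟩, h⟩, _⟩ <;> exact ⟨e, he, h⟩

theorem mem_active_advance {s : DiffusionState V} {H : Finset (V × V)} {v : V} :
    v ∈ (advance s H).rumor ∪ (advance s H).positive ↔ v ∈ s.rumor ∪ s.positive ∨
      v ∈ (advance s H).newRumor ∪ (advance s H).newPositive := by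
  simp only [advance, Finset.mem_union]
  tauto

/-- Present attempts start in active nodes, all later ones in nodes that are still inactive. No coin
is therefore used twice. -/
theorem UsesOnly.advance {G : ICNetwork V} {s : DiffusionState V} {U H : Finset (V × V)}
    (h : G.UsesOnly s U) (hH : H ⊆ G.attempts s) :
    G.UsesOnly (ICNetwork.advance s H) (U \ G.attempts s) := by
  refine ⟨fun v hv => mem_active_advance.2 (Or.inr hv), fun e he h1 h2 => ?_⟩
  have hfst : e.1 ∉ s.rumor ∪ s.positive := by
    rcases h1 with h1 | h1
    · obtain ⟨e', he', hee⟩ := new_advance h1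
      rw [← hee]
      exact (Finset.mem_filter.1 (hH he')).2.2
    · exact fun hc => h1 (mem_active_advance.2 (Or.inl hc))
  refine Finset.mem_sdiff.2 ⟨h.mem e he (Or.inr hfst)
    fun hc => h2 (mem_active_advance.2 (Or.inl hc)), fun hA => ?_⟩
  exact hfst (h.new_subset (Finset.mem_filter.1 hA).2.1)

theorem diffuseWith_congr (G : ICNetwork V) {U H H' : Finset (V × V)} (hHH : H ∩ U = H' ∩ U)
    (t : ℕ) {s : DiffusionState V} (hs : G.UsesOnly s U) :
    G.diffuseWith H t s = G.diffuseWith H' t s := by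
  induction t generalizing s U with
  | zero => rfl
  | succ t ih =>
    have h1 : H ∩ G.attempts s = H' ∩ G.attempts s := by
      rw [← Finset.inter_eq_right.2 hs.attempts_subset, ← Finset.inter_assoc, hHH,
        Finset.inter_assoc]
    have h2 : H ∩ (U \ G.attempts s) = H' ∩ (U \ G.attempts s) := by
      rw [← Finset.inter_sdiff_assoc, hHH, Finset.inter_sdiff_assoc]
    simp only [diffuseWith]
    rw [h1]
    exact ih h2 (hs.advance Finset.inter_subset_right)

/-- Deferred decisions: each coin is used at most once, so the time at which it is tossed is
irrelevant. The set `U` is kept general because the induction shrinks it to the coins not yet used.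
-/
theorem diffuse_eq_map (G : ICNetwork V) (t : ℕ) {s : DiffusionState V} {U : Finset (V × V)}
    (hs : G.UsesOnly s U) :
    G.diffuse t s = (G.tossCoins U).map fun H => G.diffuseWith H t s := by
  induction t generalizing s U with
  | zero => exact (PMF.map_const _ _).symm
  | succ t ih =>
    have h1 : G.diffuse (t + 1) s = (G.tossCoins (G.attempts s)).bind fun H =>
        (G.tossCoins (U \ G.attempts s)).map fun K => G.diffuseWith K t (ICNetwork.advance s H) := by
      simp only [diffuse]
      exact bind_congr_support _ fun H hH =>
        ih (hs.advance (G.subset_of_mem_support_tossCoins hH))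
    rw [h1]
    refine G.tossCoins_bind_map_eq hs.attempts_subset _ _ fun H hH K hK => ?_
    have h2 : (H ∪ K) ∩ G.attempts s = H := by
      ext e
      have h1 := @hH e
      have h2 := @hK e
      simp only [Finset.mem_sdiff, Finset.mem_union, Finset.mem_inter] at *
      tauto
    simp only [diffuseWith, h2]
    refine G.diffuseWith_congr (U := U \ G.attempts s) ?_ t (hs.advance hH)
    ext e
    have h1 := @hH e
    simp only [Finset.mem_sdiff, Finset.mem_union, Finset.mem_inter]
    tauto

/-- `s` is the state at time `t` of the diffusion along the edges of `H`. -/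
structure IsStateAt (H : Finset (V × V)) (Sr Sp : Finset V) (t : ℕ) (s : DiffusionState V) :
    Prop where
  rumor : ∀ v, v ∈ s.rumor ↔ RumorWins H Sr Sp t v
  positive : ∀ v, v ∈ s.positive ↔ ∃ i ≤ t, Reaches H Sp i v ∧ ¬ Reaches H Sr i v
  newRumor : ∀ v, v ∈ s.newRumor ↔
    Reaches H Sr t v ∧ ∀ r < t, ¬ Reaches H Sr r v ∧ ¬ Reaches H Sp r v
  newPositive : ∀ v, v ∈ s.newPositive ↔
    Reaches H Sp t v ∧ ¬ Reaches H Sr t v ∧ ∀ r < t, ¬ Reaches H Sp r v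

theorem isStateAt_initialState (H : Finset (V × V)) (Sr Sp : Finset V) :
    IsStateAt H Sr (Sp \ Sr) 0 (initialState Sr Sp) := by
  constructor <;> intro v <;> simp [initialState, RumorWins, reaches_zero]

/-- The first time at which either cascade can arrive decides the owner, with ties going to the
rumor. -/
theorem IsStateAt.mem_active {H : Finset (V × V)} {Sr Sp : Finset V} {t : ℕ}
    {s : DiffusionState V} (hs : IsStateAt H Sr Sp t s) (v : V) :
    v ∈ s.rumor ∪ s.positive ↔ Reaches H Sr t v ∨ Reaches H Sp t v := by
  classical
  rw [Finset.mem_union, hs.rumor, hs.positive]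
  constructor
  · rintro (⟨i, hi, h, _⟩ | ⟨i, hi, h, _⟩)
    · exact Or.inl (h.mono hi)
    · exact Or.inr (h.mono hi)
  · intro h
    have hex : ∃ i, Reaches H Sr i v ∨ Reaches H Sp i v := ⟨t, h⟩
    have hle : Nat.find hex ≤ t := Nat.find_min' hex h
    by_cases hR : Reaches H Sr (Nat.find hex) v
    · exact Or.inl ⟨_, hle, hR, fun r hr hP => Nat.find_min hex hr (Or.inr hP)⟩
    · exact Or.inr ⟨_, hle, (Nat.find_spec hex).resolve_left hR, hR⟩

/-- Plain distances in `H` ignore blocking, yet describe the process: the predecessor of `v` on a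
shortest walk of the winner must itself have just been activated by the winner. -/
theorem IsStateAt.advance {G : ICNetwork V} {H : Finset (V × V)} {Sr Sp : Finset V} {t : ℕ}
    {s : DiffusionState V} (hH : H ⊆ G.edges) (hs : IsStateAt H Sr Sp t s) :
    IsStateAt H Sr Sp (t + 1) (ICNetwork.advance s (H ∩ G.attempts s)) := by
  have hatt : ∀ w v, (w, v) ∈ H ∩ G.attempts s ↔ (w, v) ∈ H ∧
      (w ∈ s.newRumor ∨ w ∈ s.newPositive) ∧ ¬ Reaches H Sr t v ∧ ¬ Reaches H Sp t v := by
    intro w v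
    rw [attempts, Finset.mem_inter, Finset.mem_filter, hs.mem_active, Finset.mem_union, not_or]
    exact ⟨fun h => ⟨h.1, h.2.2⟩, fun h => ⟨h.1, hH h.1, h.2⟩⟩
  have hr : ∀ v, v ∈ (ICNetwork.advance s (H ∩ G.attempts s)).newRumor ↔
      Reaches H Sr (t + 1) v ∧ ∀ r < t + 1, ¬ Reaches H Sr r v ∧ ¬ Reaches H Sp r v := by
    intro v
    simp only [ICNetwork.advance, Finset.mem_image, Finset.mem_filter, Prod.exists,
      exists_eq_right, hatt, hs.newRumor]
    constructor
    · rintro ⟨w, ⟨hwv, -, h1, h2⟩, h3, -⟩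
      exact ⟨reaches_succ.2 ⟨w, h3, Or.inr hwv⟩, fun r hr =>
        ⟨fun h => h1 (h.mono (Nat.lt_succ_iff.1 hr)), fun h => h2 (h.mono (Nat.lt_succ_iff.1 hr))⟩⟩
    · rintro ⟨h1, h2⟩
      obtain ⟨w, hw, rfl | hwv⟩ := reaches_succ.1 h1
      · exact absurd hw (h2 t t.lt_succ_self).1
      -- A seed of either cascade that reaches `w` before time `t` would reach `v` by time `t`,
      -- which is excluded.
      · have h3 : ∀ r < t, ¬ Reaches H Sr r w ∧ ¬ Reaches H Sp r w := fun r hr =>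
          ⟨fun h => (h2 (r + 1) (by omega)).1 (reaches_succ.2 ⟨w, h, Or.inr hwv⟩),
            fun h => (h2 (r + 1) (by omega)).2 (reaches_succ.2 ⟨w, h, Or.inr hwv⟩)⟩
        exact ⟨w, ⟨hwv, Or.inl ⟨hw, h3⟩, h2 t t.lt_succ_self⟩, hw, h3⟩
  have hq : ∀ v, v ∈ (ICNetwork.advance s (H ∩ G.attempts s)).newPositive ↔
      Reaches H Sp (t + 1) v ∧ ¬ Reaches H Sr (t + 1) v ∧ ∀ r < t + 1, ¬ Reaches H Sp r v := by
    intro v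
    have hmem : v ∈ (ICNetwork.advance s (H ∩ G.attempts s)).newPositive ↔
        (∃ w, (w, v) ∈ H ∩ G.attempts s ∧ w ∈ s.newPositive) ∧
          v ∉ (ICNetwork.advance s (H ∩ G.attempts s)).newRumor := by
      simp [ICNetwork.advance]
    simp only [hmem, hr, hatt, hs.newPositive]
    constructor
    · rintro ⟨⟨w, ⟨hwv, -, h1, h2⟩, h3, -⟩, h4⟩
      refine ⟨reaches_succ.2 ⟨w, h3, Or.inr hwv⟩, fun h => h4 ⟨h, fun r hr =>
        ⟨fun h => h1 (h.mono (Nat.lt_succ_iff.1 hr)), fun h => h2 (h.mono (Nat.lt_succ_iff.1 hr))⟩⟩,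
        fun r hr h => h2 (h.mono (Nat.lt_succ_iff.1 hr))⟩
    · rintro ⟨h1, h2, h3⟩
      obtain ⟨w, hw, rfl | hwv⟩ := reaches_succ.1 h1
      · exact absurd hw (h3 t t.lt_succ_self)
      · have h4 : Reaches H Sp t w ∧ ¬ Reaches H Sr t w ∧ ∀ r < t, ¬ Reaches H Sp r w :=
          ⟨hw, fun h => h2 (reaches_succ.2 ⟨w, h, Or.inr hwv⟩),
            fun r hr h => h3 (r + 1) (by omega) (reaches_succ.2 ⟨w, h, Or.inr hwv⟩)⟩
        exact ⟨⟨w, ⟨hwv, Or.inr h4, fun h => h2 (h.mono t.le_succ), h3 t t.lt_succ_self⟩, h4⟩,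
          fun h => h2 h.1⟩
  refine ⟨fun v => ?_, fun v => ?_, hr, hq⟩
  · have hmem : v ∈ (ICNetwork.advance s (H ∩ G.attempts s)).rumor ↔
        v ∈ s.rumor ∨ v ∈ (ICNetwork.advance s (H ∩ G.attempts s)).newRumor := by
      simp only [ICNetwork.advance, Finset.mem_union]
    rw [hmem, hr, hs.rumor]
    constructor
    · rintro (⟨i, hi, h⟩ | ⟨h1, h2⟩)
      · exact ⟨i, hi.trans t.le_succ, h⟩
      · exact ⟨t + 1, le_rfl, h1, fun r hr => (h2 r hr).2⟩
    · rintro ⟨i, hi, h1, h2⟩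
      rcases Nat.le_succ_iff.1 hi with hi | rfl
      · exact Or.inl ⟨i, hi, h1, h2⟩
      · by_cases h3 : Reaches H Sr t v
        · exact Or.inl ⟨t, le_rfl, h3, fun r hr => h2 r (by omega)⟩
        · exact Or.inr ⟨h1, fun r hr => ⟨fun h => h3 (h.mono (Nat.lt_succ_iff.1 hr)), h2 r hr⟩⟩
  · have hmem : v ∈ (ICNetwork.advance s (H ∩ G.attempts s)).positive ↔
        v ∈ s.positive ∨ v ∈ (ICNetwork.advance s (H ∩ G.attempts s)).newPositive := by
      simp only [ICNetwork.advance, Finset.mem_union]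
    rw [hmem, hq, hs.positive]
    constructor
    · rintro (⟨i, hi, h⟩ | ⟨h1, h2, -⟩)
      · exact ⟨i, hi.trans t.le_succ, h⟩
      · exact ⟨t + 1, le_rfl, h1, h2⟩
    · rintro ⟨i, hi, h1, h2⟩
      rcases Nat.le_succ_iff.1 hi with hi | rfl
      · exact Or.inl ⟨i, hi, h1, h2⟩
      · by_cases h3 : Reaches H Sp t v
        · exact Or.inl ⟨t, le_rfl, h3, fun h => h2 (h.mono t.le_succ)⟩
        · exact Or.inr ⟨h1, h2, fun r hr h => h3 (h.mono (Nat.lt_succ_iff.1 hr))⟩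

theorem IsStateAt.diffuseWith {G : ICNetwork V} {H : Finset (V × V)} {Sr Sp : Finset V}
    (hH : H ⊆ G.edges) (t : ℕ) {i : ℕ} {s : DiffusionState V} (hs : IsStateAt H Sr Sp i s) :
    IsStateAt H Sr Sp (i + t) (G.diffuseWith H t s) := by
  induction t generalizing i s with
  | zero => exact hs
  | succ t ih =>
    have := ih (hs.advance hH)
    rwa [add_assoc, add_comm 1 t] at this

/-! ### The reverse search with coins tossed in advance -/

/-- The edges tested in the next round of the reverse search. -/
def tests (G : ICNetwork V) (nodes front : Finset V) (Et Ef : Finset (V × V)) : Finset (V × V) :=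
  G.edges.filter fun e => e.2 ∈ nodes ∪ front ∧ e.1 ∉ nodes ∪ front ∧ e ∉ Et ∪ Ef

/-- The reverse search in which a test succeeds if its edge is in `H`. -/
def rTupleWith (G : ICNetwork V) (Sr : Finset V) (H : Finset (V × V)) :
    ℕ → (nodes : Finset V) → (Et Ef : Finset (V × V)) → (front : Finset V) → RTuple V
  | 0, nodes, Et, Ef, _ => ⟨nodes, Et, Ef, false⟩
  | t + 1, nodes, Et, Ef, front =>
    if front = ∅ then ⟨nodes, Et, Ef, false⟩
    else if front ∩ Sr ≠ ∅ then ⟨nodes, Et, Ef, true⟩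
    else
      let A := G.tests nodes front Et Ef
      G.rTupleWith Sr H t (nodes ∪ front) (Et ∪ (H ∩ A)) (Ef ∪ (A \ (H ∩ A)))
        ((H ∩ A).image Prod.fst)

theorem tests_subset (G : ICNetwork V) (nodes front : Finset V) (Et Ef : Finset (V × V)) :
    G.tests nodes front Et Ef ⊆ G.edges \ (Et ∪ Ef) := by
  intro e he
  obtain ⟨h1, -, -, h2⟩ := Finset.mem_filter.1 he
  exact Finset.mem_sdiff.2 ⟨h1, h2⟩

theorem untested_succ (G : ICNetwork V) {A H Et Ef : Finset (V × V)} (hH : H ⊆ A) :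
    G.edges \ (Et ∪ H ∪ (Ef ∪ A \ H)) = (G.edges \ (Et ∪ Ef)) \ A := by
  ext e
  have h1 := @hH e
  simp only [Finset.mem_sdiff, Finset.mem_union]
  tauto

theorem rTupleWith_congr (G : ICNetwork V) (Sr : Finset V) {H H' : Finset (V × V)} (t : ℕ)
    {nodes front : Finset V} {Et Ef : Finset (V × V)}
    (hHH : H ∩ (G.edges \ (Et ∪ Ef)) = H' ∩ (G.edges \ (Et ∪ Ef))) :
    G.rTupleWith Sr H t nodes Et Ef front = G.rTupleWith Sr H' t nodes Et Ef front := by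
  induction t generalizing nodes front Et Ef with
  | zero => rfl
  | succ t ih =>
    have h1 : H ∩ G.tests nodes front Et Ef = H' ∩ G.tests nodes front Et Ef := by
      rw [← Finset.inter_eq_right.2 (G.tests_subset nodes front Et Ef), ← Finset.inter_assoc, hHH,
        Finset.inter_assoc]
    simp only [rTupleWith, h1]
    split_ifs
    · rfl
    · rfl
    · apply ih
      rw [untested_succ G Finset.inter_subset_right, ← Finset.inter_sdiff_assoc, hHH,
        Finset.inter_sdiff_assoc]

/-- Deferred decisions again; here the tested edges are recorded in `Et ∪ Ef`, and only the coins
outside matter for the rest of the search. -/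
theorem rTupleLoop_eq_map (G : ICNetwork V) (Sr : Finset V) (t : ℕ) (nodes front : Finset V)
    (Et Ef : Finset (V × V)) :
    G.rTupleLoop Sr t nodes Et Ef front =
      (G.tossCoins (G.edges \ (Et ∪ Ef))).map fun H => G.rTupleWith Sr H t nodes Et Ef front := by
  induction t generalizing nodes front Et Ef with
  | zero => exact (PMF.map_const _ _).symm
  | succ t ih =>
    by_cases hf : front = ∅
    · simp only [rTupleLoop, rTupleWith, if_pos hf]
      exact (PMF.map_const _ _).symm
    by_cases hr : front ∩ Sr ≠ ∅
    · simp only [rTupleLoop, rTupleWith, if_neg hf, if_pos hr]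
      exact (PMF.map_const _ _).symm
    simp only [rTupleLoop, rTupleWith, if_neg hf, if_neg hr]
    change ((G.tossCoins (G.tests nodes front Et Ef)).bind fun H =>
      G.rTupleLoop Sr t (nodes ∪ front) (Et ∪ H) (Ef ∪ (G.tests nodes front Et Ef \ H))
        (H.image Prod.fst)) = _
    set A := G.tests nodes front Et Ef with hA
    have hsub : A ⊆ G.edges \ (Et ∪ Ef) := G.tests_subset nodes front Et Ef
    have h1 : ((G.tossCoins A).bind fun H =>
        G.rTupleLoop Sr t (nodes ∪ front) (Et ∪ H) (Ef ∪ (A \ H)) (H.image Prod.fst)) =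
        (G.tossCoins A).bind fun H => (G.tossCoins ((G.edges \ (Et ∪ Ef)) \ A)).map fun K =>
          G.rTupleWith Sr K t (nodes ∪ front) (Et ∪ H) (Ef ∪ (A \ H)) (H.image Prod.fst) := by
      refine bind_congr_support _ fun H hH => ?_
      rw [ih, untested_succ G (G.subset_of_mem_support_tossCoins hH)]
    rw [h1]
    refine G.tossCoins_bind_map_eq hsub _ _ fun H hH K hK => ?_
    have h2 : (H ∪ K) ∩ A = H := by
      ext e
      have h1 := @hH e
      have h2 := @hK e
      simp only [Finset.mem_sdiff, Finset.mem_union, Finset.mem_inter] at *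
      tauto
    rw [h2]
    refine G.rTupleWith_congr Sr t ?_
    rw [untested_succ G hH]
    ext e
    have h1 := @hH e
    simp only [Finset.mem_sdiff, Finset.mem_union, Finset.mem_inter]
    tauto

/-- The tuple `T` is covered by `S`. -/
def Covers (S : Finset V) (T : RTuple V) : Prop := S ∩ T.nodes ≠ ∅ ∨ T.hitRumor = false

/-- Invariant of the breadth-first search after `j` rounds: `nodes` holds the distances below `j`,
`front` the distance exactly `j`, and no rumor seed has been met before. When the front meets `Sr`,
the rumor is at distance `j`, and `Sp` meets `nodes` iff it is strictly closer. -/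
theorem covers_rTupleWith_iff (G : ICNetwork V) (Sr Sp : Finset V) {H : Finset (V × V)}
    (hH : H ⊆ G.edges) (v : V) (n t j : ℕ) (hjt : j + t = n + 1) (nodes front : Finset V)
    (Et Ef : Finset (V × V)) (hnodes : ∀ u, u ∈ nodes ↔ ∃ r < j, Within H r u v)
    (hfront : ∀ u, u ∈ front ↔ Within H j u v ∧ ∀ r < j, ¬ Within H r u v)
    (htested : ∀ e ∈ Et ∪ Ef, e.2 ∈ nodes) (hSr : ∀ u ∈ Sr, u ∉ nodes) :
    Covers Sp (G.rTupleWith Sr H t nodes Et Ef front) ↔ ¬ RumorWins H Sr Sp n v := by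
  have hnot : ∀ r < j, ¬ Reaches H Sr r v := by
    rintro r hr ⟨u, hu, huv⟩
    exact hSr u hu ((hnodes u).2 ⟨r, hr, huv⟩)
  induction t generalizing j nodes front Et Ef with
  | zero =>
    -- Out of rounds means `j = n + 1`, so no rumor seed lies within the horizon `n`; termination of
    -- the search need not be shown separately.
    simp only [rTupleWith, Covers, or_true, true_iff]
    rintro ⟨i, hi, h, -⟩
    exact hnot i (by omega) h
  | succ t ih =>
    by_cases hf : front = ∅
    · simp only [rTupleWith, if_pos hf, Covers, or_true, true_iff]
      -- An empty layer `j` cuts off all greater distances, so every node that can reach `v` has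
      -- been collected.
      have hall : ∀ s u, Within H s u v → u ∈ nodes := by
        intro s
        have hj : ∀ u, Within H j u v → u ∈ nodes := by
          intro u hu
          by_contra hc
          have : u ∈ front := (hfront u).2 ⟨hu, fun r hr h => hc ((hnodes u).2 ⟨r, hr, h⟩)⟩
          simp [hf] at this
        induction s with
        | zero => exact fun u hu => hj u (hu.mono (Nat.zero_le j))
        | succ s ih =>
          intro u hu
          obtain ⟨w, huw, hw⟩ := within_succ_left.1 hu
          obtain ⟨r, hr, hrw⟩ := (hnodes w).1 (ih w hw)
          exact hj u ((within_succ_left.2 ⟨w, huw, hrw⟩).mono hr)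
      rintro ⟨i, -, ⟨u, hu, huv⟩, -⟩
      exact hSr u hu (hall i u huv)
    by_cases hr : front ∩ Sr ≠ ∅
    · simp only [rTupleWith, if_neg hf, if_pos hr, Covers, Bool.true_eq_false, or_false,
        ne_eq, not_iff_not]
      obtain ⟨u, hu⟩ := Finset.nonempty_iff_ne_empty.2 hr
      obtain ⟨huf, hus⟩ := Finset.mem_inter.1 hu
      constructor
      · intro he
        refine ⟨j, by omega, ⟨u, hus, ((hfront u).1 huf).1⟩, ?_⟩
        rintro r hr ⟨w, hw, hwv⟩
        have : w ∈ Sp ∩ nodes := Finset.mem_inter.2 ⟨hw, (hnodes w).2 ⟨r, hr, hwv⟩⟩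
        simp [he] at this
      · rintro ⟨i, -, hi, hP⟩
        have hji : j ≤ i := by
          by_contra hc
          exact hnot i (by omega) hi
        rw [Finset.eq_empty_iff_forall_notMem]
        intro w hw
        obtain ⟨hwS, hwn⟩ := Finset.mem_inter.1 hw
        obtain ⟨r, hr, hrw⟩ := (hnodes w).1 hwn
        exact hP r (by omega) ⟨w, hwS, hrw⟩
    · simp only [rTupleWith, if_neg hf, if_neg hr]
      rw [not_not, Finset.eq_empty_iff_forall_notMem] at hr
      have hnodes' : ∀ u, u ∈ nodes ∪ front ↔ ∃ r < j + 1, Within H r u v := by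
        intro u
        rw [Finset.mem_union, hnodes, hfront]
        constructor
        · rintro (⟨r, hr, h⟩ | ⟨h, -⟩)
          · exact ⟨r, by omega, h⟩
          · exact ⟨j, by omega, h⟩
        · rintro ⟨r, hr, h⟩
          by_cases hex : ∃ r < j, Within H r u v
          · exact Or.inl hex
          · push Not at hex
            exact Or.inr ⟨h.mono (by omega), hex⟩
      have hSr' : ∀ u ∈ Sr, u ∉ nodes ∪ front := by
        intro u hu hc
        rcases Finset.mem_union.1 hc with h | h
        · exact hSr u hu h
        · exact hr u (Finset.mem_inter.2 ⟨h, hu⟩)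
      refine ih (j + 1) (by omega) _ _ _ _ hnodes' ?_ ?_ hSr' ?_
      · intro u
        simp only [Finset.mem_image, Finset.mem_inter, Prod.exists, exists_and_right,
          exists_eq_right]
        constructor
        · rintro ⟨w, hw, hA⟩
          obtain ⟨-, h1, h2, -⟩ := Finset.mem_filter.1 hA
          obtain ⟨r, hr, h⟩ := (hnodes' w).1 h1
          refine ⟨(within_succ_left.2 ⟨w, Or.inr hw, h⟩).mono (by omega), fun r hr h => ?_⟩
          exact h2 ((hnodes' u).2 ⟨r, hr, h⟩)
        · rintro ⟨h1, h2⟩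
          obtain ⟨w, rfl | huw, hw⟩ := within_succ_left.1 h1
          · exact absurd hw (h2 j (by omega))
          · have hwf : ∀ r < j, ¬ Within H r w v := fun r hr h =>
              h2 (r + 1) (by omega) (within_succ_left.2 ⟨w, Or.inr huw, h⟩)
            refine ⟨w, huw, Finset.mem_filter.2 ⟨hH huw, ?_, ?_, ?_⟩⟩
            · exact Finset.mem_union_right _ ((hfront w).2 ⟨hw, hwf⟩)
            · intro hc
              obtain ⟨r, hr, h⟩ := (hnodes' u).1 hc
              exact h2 r hr h
            -- Tested edges end in `nodes`, whereas `w` lies in the front: the edge still awaits its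
            -- test.
            · intro hc
              obtain ⟨r, hr, h⟩ := (hnodes w).1 (htested _ hc)
              exact hwf r hr h
      · intro e he
        by_cases hA : e ∈ G.tests nodes front Et Ef
        · exact (Finset.mem_filter.1 hA).2.1
        · refine Finset.mem_union_left _ (htested e ?_)
          simp only [Finset.mem_union, Finset.mem_inter, Finset.mem_sdiff] at he ⊢
          tauto
      · rintro r hr ⟨u, hu, huv⟩
        exact hSr' u hu ((hnodes' u).2 ⟨r, hr, huv⟩)

/-! ### The objective in terms of random R-tuples -/

variable [Fintype V]

theorem rTupleOf_covers (G : ICNetwork V) (Sr Sp : Finset V) (v : V) :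
    (G.rTupleOf Sr v).toOuterMeasure {T | Covers Sp T} =
      (G.tossCoins G.edges).toOuterMeasure {H | ¬ RumorWins H Sr Sp (Fintype.card V) v} := by
  rw [rTupleOf, rTupleLoop_eq_map, PMF.toOuterMeasure_map_apply, Finset.union_self,
    Finset.sdiff_empty]
  refine toOuterMeasure_congr_support _ fun H hH => ?_
  exact G.covers_rTupleWith_iff Sr Sp (G.subset_of_mem_support_tossCoins hH) v _ _ 0
    (by omega) _ _ _ _ (by simp) (by simp [Within]) (by simp) (by simp)

theorem rumorLaw_notMem (G : ICNetwork V) (Sr Sp : Finset V) (v : V) :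
    (G.rumorLaw Sr Sp).toOuterMeasure {A | v ∉ A} =
      (G.tossCoins G.edges).toOuterMeasure {H | ¬ RumorWins H Sr Sp (Fintype.card V) v} := by
  have huse : G.UsesOnly (initialState Sr Sp) G.edges :=
    ⟨by simp [initialState], fun e he _ _ => he⟩
  rw [rumorLaw, G.diffuse_eq_map _ huse, PMF.map_comp, PMF.toOuterMeasure_map_apply]
  refine toOuterMeasure_congr_support _ fun H hH => ?_
  have := ((isStateAt_initialState H Sr Sp).diffuseWith
    (G.subset_of_mem_support_tossCoins hH) (Fintype.card V)).rumor v
  rw [zero_add, rumorWins_sdiff] at this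
  exact not_congr this

/-- Probability that a random R-tuple is covered by `S`. -/
noncomputable def coverProb [Nonempty V] (G : ICNetwork V) (Sr S : Finset V) : ℝ :=
  ((G.rTuple Sr).toOuterMeasure {T | Covers S T}).toReal

theorem objective_eq_sum (G : ICNetwork V) (Sr Sp : Finset V) :
    G.objective Sr Sp = ∑ v, ((G.rTupleOf Sr v).toOuterMeasure {T | Covers Sp T}).toReal := by
  have h : ∀ v, ((G.rTupleOf Sr v).toOuterMeasure {T | Covers Sp T}).toReal =
      ∑ A : Finset V, (G.rumorLaw Sr Sp A).toReal * if v ∈ Aᶜ then 1 else 0 := by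
    intro v
    rw [rTupleOf_covers, ← rumorLaw_notMem, PMF.toOuterMeasure_apply, tsum_fintype,
      ENNReal.toReal_sum]
    · refine Finset.sum_congr rfl fun A _ => ?_
      by_cases hv : v ∈ A <;> simp [hv]
    · intro A _
      by_cases hv : v ∈ A <;> simp [hv, PMF.apply_ne_top]
  simp only [h]
  rw [Finset.sum_comm, objective]
  refine Finset.sum_congr rfl fun A _ => ?_
  rw [← Finset.mul_sum, Finset.sum_boole, Finset.filter_mem_eq_inter, Finset.univ_inter]

/-- The uniform root turns the sum of the escape probabilities over all nodes into `n` times a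
single probability. -/
theorem objective_eq (G : ICNetwork V) [Nonempty V] (Sr Sp : Finset V) :
    G.objective Sr Sp = Fintype.card V * G.coverProb Sr Sp := by
  have hc : (Fintype.card V : ℝ) ≠ 0 := by exact_mod_cast Fintype.card_ne_zero
  rw [objective_eq_sum, coverProb, rTuple, bind_toOuterMeasure, expect, tsum_fintype,
    ENNReal.toReal_sum, Finset.mul_sum]
  · refine Finset.sum_congr rfl fun v _ => ?_
    simp [ENNReal.toReal_mul, hc]
  · intro v _
    exact ENNReal.mul_ne_top (PMF.apply_ne_top _ _)
      (ne_top_of_le_ne_top ENNReal.one_ne_top (toOuterMeasure_le_one _ _))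

end ICNetwork

end RumorBlocking

namespace RumorBlocking

variable {V : Type*} [DecidableEq V]

open ICNetwork (Covers)

/-! ### Chernoff bounds for the coverage -/

theorem coverage_nil (S : Finset V) : coverage S [] = 0 := rfl

theorem coverage_cons_of_covers {S : Finset V} {T : RTuple V} (h : Covers S T)
    (R : List (RTuple V)) : coverage S (T :: R) = coverage S R + 1 :=
  List.countP_cons_of_pos (decide_eq_true h)

theorem coverage_cons_of_not_covers {S : Finset V} {T : RTuple V} (h : ¬ Covers S T)
    (R : List (RTuple V)) : coverage S (T :: R) = coverage S R :=
  List.countP_cons_of_neg (mt of_decide_eq_true h)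

theorem coverage_le_length (S : Finset V) (R : List (RTuple V)) : coverage S R ≤ R.length :=
  List.countP_le_length

theorem coverage_mono {S S' : Finset V} (h : S ⊆ S') (R : List (RTuple V)) :
    coverage S R ≤ coverage S' R := by
  refine List.countP_mono_left fun T _ => ?_
  simp only [decide_eq_true_iff]
  refine Or.imp_left fun hS hS' => hS ?_
  exact Finset.subset_empty.1 (hS' ▸ Finset.inter_subset_inter_right h)

variable [Fintype V]

namespace ICNetwork

variable [Nonempty V]

/-- Makes the list that the estimation tops up from round to round, taken as a whole, an independent
sample of its final length. -/
theorem rTuples_add (G : ICNetwork V) (Sr : Finset V) (a b : ℕ) :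
    G.rTuples Sr (a + b) = (G.rTuples Sr a).bind fun R => (G.rTuples Sr b).map fun R₀ => R ++ R₀ := by
  induction a with
  | zero =>
    simp only [rTuples, PMF.pure_bind, Nat.zero_add, List.nil_append]
    exact (PMF.map_id _).symm
  | succ a ih =>
    rw [Nat.add_right_comm]
    simp only [rTuples, ih, PMF.bind_bind, PMF.map_bind, PMF.bind_map, PMF.map_comp]
    rfl

theorem length_of_mem_support_rTuples (G : ICNetwork V) (Sr : Finset V) {m : ℕ}
    {R : List (RTuple V)} (hR : R ∈ (G.rTuples Sr m).support) : R.length = m := by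
  induction m generalizing R with
  | zero =>
    simp only [rTuples, PMF.support_pure, Set.mem_singleton_iff] at hR
    simp [hR]
  | succ m ih =>
    simp only [rTuples, PMF.mem_support_bind_iff, PMF.mem_support_map_iff] at hR
    obtain ⟨T, -, R', hR', rfl⟩ := hR
    simp [ih hR']

theorem coverProb_nonneg (G : ICNetwork V) (Sr S : Finset V) : 0 ≤ G.coverProb Sr S :=
  ENNReal.toReal_nonneg

theorem coverProb_le_one (G : ICNetwork V) (Sr S : Finset V) : G.coverProb Sr S ≤ 1 :=
  ENNReal.toReal_le_of_le_ofReal zero_le_one (by simpa using toOuterMeasure_le_one _ _)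

theorem ofReal_coverProb (G : ICNetwork V) (Sr S : Finset V) :
    (G.rTuple Sr).toOuterMeasure {T | Covers S T} = ENNReal.ofReal (G.coverProb Sr S) :=
  (ENNReal.ofReal_toReal
    (ne_top_of_le_ne_top ENNReal.one_ne_top (toOuterMeasure_le_one _ _))).symm

theorem one_add_coverProb_mul_nonneg (G : ICNetwork V) (Sr S : Finset V) (θ : ℝ) :
    0 ≤ 1 + G.coverProb Sr S * (Real.exp θ - 1) := by
  nlinarith [G.coverProb_nonneg Sr S, G.coverProb_le_one Sr S, Real.exp_pos θ,
    mul_nonneg (G.coverProb_nonneg Sr S) (Real.exp_pos θ).le]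

theorem expect_rTuple_ite (G : ICNetwork V) (Sr S : Finset V) (θ : ℝ) :
    (expect (G.rTuple Sr) fun T => {T | Covers S T}.indicator (fun _ => 1) T *
        ENNReal.ofReal (Real.exp θ) + {T | Covers S T}ᶜ.indicator (fun _ => 1) T) =
      ENNReal.ofReal (1 + G.coverProb Sr S * (Real.exp θ - 1)) := by
  have hc : (G.rTuple Sr).toOuterMeasure {T | Covers S T}ᶜ =
      ENNReal.ofReal (1 - G.coverProb Sr S) := by
    have h := toOuterMeasure_add_compl (G.rTuple Sr) {T | Covers S T}
    rw [ofReal_coverProb] at h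
    rw [ENNReal.ofReal_sub _ (G.coverProb_nonneg Sr S), ENNReal.ofReal_one, ← h,
      ENNReal.add_sub_cancel_left ENNReal.ofReal_ne_top]
  rw [expect_add, expect_mul_right, ← toOuterMeasure_eq_expect, ← toOuterMeasure_eq_expect, hc,
    ofReal_coverProb, ← ENNReal.ofReal_mul (G.coverProb_nonneg Sr S),
    ← ENNReal.ofReal_add (mul_nonneg (G.coverProb_nonneg Sr S) (Real.exp_pos θ).le)
      (sub_nonneg.2 (G.coverProb_le_one Sr S))]
  congr 1
  ring

/-- Moment generating function of the coverage of independent random R-tuples. -/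
theorem expect_exp_coverage (G : ICNetwork V) (Sr S : Finset V) (θ : ℝ) (m : ℕ) :
    (expect (G.rTuples Sr m) fun R => ENNReal.ofReal (Real.exp (θ * coverage S R))) =
      ENNReal.ofReal ((1 + G.coverProb Sr S * (Real.exp θ - 1)) ^ m) := by
  induction m with
  | zero => simp [rTuples, expect_pure, coverage_nil]
  | succ m ih =>
    rw [pow_succ', ENNReal.ofReal_mul (G.one_add_coverProb_mul_nonneg Sr S θ), ← ih,
      ← expect_rTuple_ite, ← expect_mul_right]
    simp only [rTuples, expect_bind, expect_map]
    congr 1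
    funext T
    by_cases hT : Covers S T
    · simp only [coverage_cons_of_covers hT, Set.indicator, Set.mem_ofPred_eq, hT, if_true,
        Set.mem_compl_iff, not_true, if_false, one_mul, add_zero]
      rw [mul_comm, ← expect_mul_right]
      congr 1
      funext R
      rw [← ENNReal.ofReal_mul (Real.exp_pos _).le, ← Real.exp_add]
      congr 2
      push_cast
      ring
    · simp only [coverage_cons_of_not_covers hT, Set.indicator, Set.mem_ofPred_eq, hT, if_true,
        Set.mem_compl_iff, not_false_iff, if_false, one_mul, zero_mul, zero_add]

/-- The exponential Markov inequality for the coverage: an upper tail bound if `θ > 0` and a lower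
tail bound if `θ < 0`. -/
theorem coverage_tail_le (G : ICNetwork V) (Sr S : Finset V) (θ a : ℝ) (m : ℕ) :
    (G.rTuples Sr m).toOuterMeasure {R | 0 ≤ θ * (coverage S R - a)} ≤
      ENNReal.ofReal (Real.exp (-(θ * a)) * (1 + G.coverProb Sr S * (Real.exp θ - 1)) ^ m) := by
  rw [mul_comm, ENNReal.ofReal_mul (pow_nonneg (G.one_add_coverProb_mul_nonneg Sr S θ) m),
    ← expect_exp_coverage, ← expect_mul_right, toOuterMeasure_eq_expect]
  refine expect_mono _ fun R _ => ?_
  by_cases hR : 0 ≤ θ * (coverage S R - a)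
  · rw [Set.indicator_of_mem (by exact hR), ← ENNReal.ofReal_mul (Real.exp_pos _).le,
      ← Real.exp_add, ← ENNReal.ofReal_one]
    exact ENNReal.ofReal_le_ofReal (Real.one_le_exp (by linarith))
  · rw [Set.indicator_of_notMem (by exact hR)]
    exact zero_le

/-- Uses 1 + x ≤ exp x in every factor. The product form is kept as well, since
`coverage_overestimate_le` treats one factor separately. -/
theorem coverage_tail_le_exp (G : ICNetwork V) (Sr S : Finset V) (θ a : ℝ) (m : ℕ) :
    (G.rTuples Sr m).toOuterMeasure {R | 0 ≤ θ * (coverage S R - a)} ≤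
      ENNReal.ofReal (Real.exp (m * G.coverProb Sr S * (Real.exp θ - 1) - θ * a)) := by
  refine (G.coverage_tail_le Sr S θ a m).trans (ENNReal.ofReal_le_ofReal ?_)
  rw [sub_eq_neg_add (_ * _), Real.exp_add, mul_assoc, Real.exp_nat_mul]
  gcongr
  · exact G.one_add_coverProb_mul_nonneg Sr S θ
  · rw [add_comm]
    exact Real.add_one_le_exp _

/-- Take reciprocals in exp x ≥ 1 + x + x²/2 and note (1 + x + x²/2)(1 - x + x²/2) = 1 + x⁴/4 ≥ 1.
-/
theorem exp_neg_le_one_sub_add {x : ℝ} (hx : 0 ≤ x) : Real.exp (-x) ≤ 1 - x + x ^ 2 / 2 := by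
  have h := Real.quadratic_le_exp_of_nonneg hx
  have h1 : 0 < 1 + x + x ^ 2 / 2 := by positivity
  rw [Real.exp_neg, inv_le_comm₀ (Real.exp_pos x) (by nlinarith [sq_nonneg (x - 1)])]
  refine le_trans ?_ h
  rw [inv_le_iff_one_le_mul₀ (by nlinarith [sq_nonneg (x - 1)])]
  nlinarith [sq_nonneg (x ^ 2)]

/-- The choice θ = -δ instead of the optimal log (1 - δ) already gives the exponent δ²/2 and avoids
the restriction δ < 1. -/
theorem coverage_lower_tail (G : ICNetwork V) (Sr S : Finset V) {δ : ℝ} (hδ : 0 ≤ δ) (m : ℕ) :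
    (G.rTuples Sr m).toOuterMeasure
        {R | (coverage S R : ℝ) ≤ (1 - δ) * (m * G.coverProb Sr S)} ≤
      ENNReal.ofReal (Real.exp (-(δ ^ 2 * (m * G.coverProb Sr S) / 2))) := by
  have hμ : 0 ≤ m * G.coverProb Sr S := mul_nonneg m.cast_nonneg (G.coverProb_nonneg Sr S)
  refine (toOuterMeasure_mono_support _ fun R _ hR => ?_).trans
    ((G.coverage_tail_le_exp Sr S (-δ) ((1 - δ) * (m * G.coverProb Sr S)) m).trans
      (ENNReal.ofReal_le_ofReal (Real.exp_le_exp.2 ?_)))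
  · exact mul_nonneg_of_nonpos_of_nonpos (neg_nonpos.2 hδ) (sub_nonpos.2 hR)
  · nlinarith [mul_le_mul_of_nonneg_left (exp_neg_le_one_sub_add hδ) hμ]

/-- Comes from log (1 + ε) ≥ 2ε/(2 + ε), and is the source of the factors 2 + δ in the sample sizes.
-/
theorem sq_div_le_one_add_mul_log_sub {ε : ℝ} (hε : 0 ≤ ε) :
    ε ^ 2 / (2 + ε) ≤ (1 + ε) * Real.log (1 + ε) - ε := by
  have h := mul_le_mul_of_nonneg_left (Real.le_log_one_add_of_nonneg hε)
    (by linarith : 0 ≤ 1 + ε)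
  have h2 : (1 + ε) * (2 * ε / (ε + 2)) - ε = ε ^ 2 / (2 + ε) := by
    field_simp
    ring
  linarith

/-- Upper tail of the coverage, for a deviation relative to an upper bound `M` of its mean. -/
theorem coverage_upper_tail (G : ICNetwork V) (Sr S : Finset V) {ε M : ℝ} (hε : 0 ≤ ε)
    (hM : G.coverProb Sr S ≤ M) (m : ℕ) :
    (G.rTuples Sr m).toOuterMeasure
        {R | m * (G.coverProb Sr S + ε * M) ≤ (coverage S R : ℝ)} ≤
      ENNReal.ofReal (Real.exp (-(ε ^ 2 / (2 + ε) * (m * M)))) := by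
  have hlog0 : 0 ≤ Real.log (1 + ε) := Real.log_nonneg (by linarith)
  have hlog1 : Real.log (1 + ε) ≤ ε := by
    have := Real.log_le_sub_one_of_pos (by linarith : 0 < 1 + ε)
    linarith
  refine (toOuterMeasure_mono_support _ fun R _ hR => ?_).trans
    ((G.coverage_tail_le_exp Sr S (Real.log (1 + ε)) (m * (G.coverProb Sr S + ε * M)) m).trans
      (ENNReal.ofReal_le_ofReal (Real.exp_le_exp.2 ?_)))
  · exact mul_nonneg hlog0 (sub_nonneg.2 hR)
  · rw [Real.exp_log (by linarith)]
    have hm : (0 : ℝ) ≤ m := m.cast_nonneg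
    have h0 := G.coverProb_nonneg Sr S
    have h1 := mul_le_mul_of_nonneg_right (sq_div_le_one_add_mul_log_sub hε)
      (mul_nonneg hm (h0.trans hM))
    -- Since log (1 + ε) ≤ ε, the exponent grows with the mean, so a mean equal to `M` is the worst
    -- case.
    have h2 := mul_le_mul_of_nonneg_left hM (mul_nonneg hm (sub_nonneg.2 hlog1))
    nlinarith

end ICNetwork

/-! ### The approximation ratio of the greedy selection -/

/-- The number of tuples of `R` whose cover set meets `S`. -/
def meetCount (R : List (RTuple V)) (S : Finset V) : ℕ :=
  R.countP fun T => decide (S ∩ T.coverSet ≠ ∅)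

theorem meetCount_insert (R : List (RTuple V)) (S : Finset V) (v : V) :
    meetCount R (insert v S) = meetCount R S + gain R S v := by
  induction R with
  | nil => rfl
  | cons T R ih =>
    simp only [meetCount, gain, List.countP_cons, decide_eq_true_iff] at ih ⊢
    rw [ih]
    by_cases hv : v ∈ T.coverSet
    · by_cases hS : S ∩ T.coverSet = ∅
      · simp [Finset.insert_inter_of_mem, hv, hS]
        omega
      · simp [Finset.insert_inter_of_mem, hv, hS]
        omega
    · simp [Finset.insert_inter_of_notMem, hv]
      omega

/-- Submodularity: a tuple met by `O` but not by `S` is counted in the gain of some node of `O`. -/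
theorem meetCount_le_add_sum (R : List (RTuple V)) (O S : Finset V) :
    meetCount R O ≤ meetCount R S + ∑ u ∈ O, gain R S u := by
  induction R with
  | nil => simp [meetCount]
  | cons T R ih =>
    simp only [meetCount, gain, List.countP_cons, decide_eq_true_iff, Finset.sum_add_distrib] at ih ⊢
    have : (if O ∩ T.coverSet ≠ ∅ then 1 else 0) ≤ (if S ∩ T.coverSet ≠ ∅ then 1 else 0) +
        ∑ u ∈ O, if S ∩ T.coverSet = ∅ ∧ u ∈ T.coverSet then 1 else 0 := by
      by_cases hS : S ∩ T.coverSet = ∅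
      · by_cases hO : O ∩ T.coverSet = ∅
        · simp [hO]
        · obtain ⟨u, hu⟩ := Finset.nonempty_iff_ne_empty.2 hO
          obtain ⟨h1, h2⟩ := Finset.mem_inter.1 hu
          have := Finset.single_le_sum
            (f := fun u => if S ∩ T.coverSet = ∅ ∧ u ∈ T.coverSet then 1 else 0)
            (fun _ _ => Nat.zero_le _) h1
          simp only [hS, h2, and_self, if_true] at this
          simpa [hO, hS] using this
      · simp only [hS, ne_eq, not_false_iff, if_true]
        split_ifs <;> omega
    omega

theorem gain_eq_zero_of_mem {R : List (RTuple V)} {S : Finset V} {u : V} (hu : u ∈ S) :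
    gain R S u = 0 := by
  rw [gain, List.countP_eq_zero]
  intro T _
  simp only [decide_eq_true_iff, not_and]
  intro hS hT
  have : u ∈ S ∩ T.coverSet := Finset.mem_inter.2 ⟨hu, hT⟩
  simp [hS] at this

theorem GreedySelects.card {R : List (RTuple V)} {j : ℕ} {S : Finset V}
    (h : GreedySelects R j S) : S.card = j := by
  induction h with
  | zero => rfl
  | succ _ hv _ ih => rw [Finset.card_insert_of_notMem hv, ih]

/-- Some node of `O` gains at least a `1/k` share of the deficit, and the greedy choice gains no
less. Each round thus shrinks the deficit by the factor 1 - 1/k. -/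
theorem GreedySelects.deficit_le {R : List (RTuple V)} {j : ℕ} {S : Finset V}
    (h : GreedySelects R j S) {k : ℕ} (hk : 1 ≤ k) {O : Finset V} (hO : O.card ≤ k) :
    (meetCount R O : ℝ) - meetCount R S ≤ (1 - 1 / k) ^ j * meetCount R O := by
  have hk' : (1 : ℝ) ≤ k := by exact_mod_cast hk
  induction h with
  | zero => simp
  | @succ j S v hS hv hmax ih =>
    have hmax' : ∀ u ∈ O, gain R S u ≤ gain R S v := by
      intro u _
      by_cases hu : u ∈ S
      · simp [gain_eq_zero_of_mem hu]
      · exact hmax u hu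
    have h1 : meetCount R O ≤ meetCount R S + k * gain R S v := by
      refine (meetCount_le_add_sum R O S).trans (Nat.add_le_add_left ?_ _)
      refine (Finset.sum_le_card_nsmul O _ _ hmax').trans ?_
      rw [smul_eq_mul]
      exact Nat.mul_le_mul_right _ hO
    have h2 : (meetCount R O : ℝ) ≤ meetCount R S + k * gain R S v := by exact_mod_cast h1
    have h3 : ((meetCount R O : ℝ) - meetCount R S) / k ≤ gain R S v := by
      rw [div_le_iff₀ (by linarith)]
      linarith
    have h4 : 0 ≤ 1 - 1 / (k : ℝ) := by
      rw [sub_nonneg, div_le_one (by linarith)]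
      exact hk'
    rw [meetCount_insert, pow_succ']
    push_cast
    have h5 := mul_le_mul_of_nonneg_left ih h4
    calc (meetCount R O : ℝ) - (meetCount R S + gain R S v)
        ≤ (1 - 1 / k) * ((meetCount R O : ℝ) - meetCount R S) := by
          rw [sub_mul, one_mul, one_div_mul_eq_div]
          linarith
      _ ≤ _ := by rw [mul_assoc]; exact h5

/-- Fails for the empty set: a tuple with `B = 0` counts as covered by it, but its cover set, all of
`V`, is not met. -/
theorem coverage_eq_meetCount {S : Finset V} (hS : S.Nonempty) (R : List (RTuple V)) :
    coverage S R = meetCount R S := by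
  refine List.countP_congr fun T _ => ?_
  rw [decide_eq_true_iff, decide_eq_true_iff, RTuple.coverSet]
  by_cases hT : T.hitRumor = true
  · simp [hT]
  · simpa [hT] using hS.ne_empty

/-- The greedy selection covers at least a fraction `1 - 1/e` of what any `k` nodes cover. -/
theorem GreedySelects.coverage_ge {R : List (RTuple V)} {k : ℕ} {S : Finset V}
    (h : GreedySelects R k S) (hk : 1 ≤ k) {O : Finset V} (hO : O.card ≤ k) :
    (1 - 1 / Real.exp 1) * coverage O R ≤ coverage S R := by
  have hexp : 0 < 1 / Real.exp 1 := by positivity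
  rcases O.eq_empty_or_nonempty with rfl | hOne
  · have : (coverage ∅ R : ℝ) ≤ coverage S R := by
      exact_mod_cast coverage_mono (Finset.empty_subset S) R
    nlinarith [(coverage (∅ : Finset V) R).cast_nonneg (α := ℝ)]
  · have hS : S.Nonempty := Finset.card_pos.1 (by rw [h.card]; omega)
    rw [coverage_eq_meetCount hOne, coverage_eq_meetCount hS]
    have h1 := h.deficit_le hk hO
    have h2 : (1 - 1 / (k : ℝ)) ^ k ≤ 1 / Real.exp 1 := by
      have := Real.one_sub_div_pow_le_exp_neg (n := k) (t := 1) (by exact_mod_cast hk)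
      rwa [Real.exp_neg, ← one_div] at this
    have h3 := mul_le_mul_of_nonneg_right h2 (meetCount R O).cast_nonneg (α := ℝ)
    linarith

end RumorBlocking

namespace RumorBlocking

variable {V : Type*} [DecidableEq V] [Fintype V]

namespace ICNetwork

/-! ### The optimum -/

theorem objective_le_opt (G : ICNetwork V) (Sr : Finset V) {k : ℕ} {S : Finset V}
    (hS : S.card ≤ k) : G.objective Sr S ≤ G.opt Sr k :=
  Finset.le_sup' (G.objective Sr) (Finset.mem_filter.2 ⟨Finset.mem_univ S, hS⟩)

theorem exists_objective_eq_opt (G : ICNetwork V) (Sr : Finset V) (k : ℕ) :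
    ∃ O : Finset V, O.card ≤ k ∧ G.objective Sr O = G.opt Sr k := by
  obtain ⟨O, hO, h⟩ := Finset.exists_mem_eq_sup' (s := (Finset.univ : Finset (Finset V)).filter
    fun S => S.card ≤ k) ⟨∅, by simp⟩ (G.objective Sr)
  exact ⟨O, (Finset.mem_filter.1 hO).2, h.symm⟩

theorem coverProb_le_opt_div (G : ICNetwork V) [Nonempty V] (Sr : Finset V) {k : ℕ}
    {S : Finset V} (hS : S.card ≤ k) : G.coverProb Sr S ≤ G.opt Sr k / Fintype.card V := by
  have hn : (0 : ℝ) < Fintype.card V := by exact_mod_cast Fintype.card_pos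
  rw [le_div_iff₀ hn, mul_comm, ← objective_eq]
  exact G.objective_le_opt Sr hS

/-- The positive seed `v` itself is always saved. This justifies the default estimate 1. -/
theorem one_le_opt (G : ICNetwork V) {Sr : Finset V} {k : ℕ} (hk : 1 ≤ k) {v : V} (hv : v ∉ Sr) :
    1 ≤ G.opt Sr k := by
  refine le_trans ?_ (G.objective_le_opt Sr (S := {v}) (by simpa using hk))
  rw [objective_eq_sum]
  refine le_trans ?_ (Finset.single_le_sum (fun _ _ => ENNReal.toReal_nonneg) (Finset.mem_univ v))
  rw [rTupleOf_covers, toOuterMeasure_congr_support (t := Set.univ)]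
  · rw [toOuterMeasure_eq_expect, Set.indicator_univ, expect_const]
    simp
  · intro H _
    simp only [Set.mem_univ, iff_true]
    rintro ⟨i, -, hR, hP⟩
    rcases Nat.eq_zero_or_pos i with rfl | hi
    · exact hv (reaches_zero.1 hR)
    · exact hP 0 hi (reaches_zero.2 (Finset.mem_singleton_self v))

theorem objective_univ (G : ICNetwork V) (S : Finset V) : G.objective Finset.univ S = 0 := by
  rw [objective_eq_sum]
  refine Finset.sum_eq_zero fun v _ => ?_
  rw [rTupleOf_covers, toOuterMeasure_congr_support (t := ∅)]
  · simp
  · intro H _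
    simp only [Set.mem_empty_iff_false, iff_false]
    exact fun h => h ⟨0, Nat.zero_le _, reaches_zero.2 (Finset.mem_univ v), by simp⟩

variable [Nonempty V]

/-! ### The estimation of the optimum -/

/-- In an iteration of the estimation, a fixed set is unlikely to pass the test and to exceed the
optimum. One tuple more than `l` may be drawn, which costs the factor `3`. -/
theorem coverage_overestimate_le (G : ICNetwork V) (Sr S : Finset V) {δ l K M₀ : ℝ} (hδ : 0 < δ)
    (hl : 0 < l) (hK : 1 < (1 + δ) * K) (hM₀ : G.coverProb Sr S ≤ M₀) :
    (G.rTuples Sr (⌊l⌋₊ + 1)).toOuterMeasure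
        {R | (1 + δ) * K ≤ (coverage S R : ℝ) ∧ (1 + δ) * (l * M₀) < coverage S R} ≤
      ENNReal.ofReal (3 * Real.exp (-(δ ^ 2 / (2 + δ) * K))) := by
  have hμ := G.coverProb_nonneg Sr S
  have hfl : (⌊l⌋₊ : ℝ) ≤ l := Nat.floor_le hl.le
  -- If the event is impossible the bound is trivial. Otherwise a single sample in it forces `l ≥ 1`
  -- and `(1 + δ) M₀ < 2`, because the coverage is at most `⌊l⌋₊ + 1`.
  by_cases hex : ∃ R ∈ (G.rTuples Sr (⌊l⌋₊ + 1)).support,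
      (1 + δ) * K ≤ (coverage S R : ℝ) ∧ (1 + δ) * (l * M₀) < coverage S R
  · obtain ⟨R, hR, h1, h2⟩ := hex
    have hlen : (coverage S R : ℝ) ≤ ⌊l⌋₊ + 1 := by
      have := coverage_le_length S R
      rw [G.length_of_mem_support_rTuples Sr hR] at this
      exact_mod_cast this
    have hl1 : 1 ≤ l := by
      by_contra hc
      rw [Nat.floor_eq_zero.2 (not_le.1 hc), Nat.cast_zero] at hlen
      linarith
    have hfac : G.coverProb Sr S * δ ≤ 2 := by
      have h3 : l * ((1 + δ) * M₀) < l * 2 := by linarith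
      have h4 := lt_of_mul_lt_mul_left h3 hl.le
      nlinarith
    have hlog0 : 0 ≤ Real.log (1 + δ) := Real.log_nonneg (by linarith)
    refine (toOuterMeasure_mono_support _ fun R _ hR => ?_).trans
      ((G.coverage_tail_le Sr S (Real.log (1 + δ)) ((1 + δ) * max (l * M₀) K) _).trans
        (ENNReal.ofReal_le_ofReal ?_))
    · refine mul_nonneg hlog0 (sub_nonneg.2 ?_)
      rw [mul_max_of_nonneg _ _ (by linarith)]
      exact max_le hR.2.le hR.1
    -- The factor of the surplus tuple is split off; it is at most 1 + 2 = 3.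
    · rw [Real.exp_log (by linarith), add_sub_cancel_left, pow_succ]
      have hpow : (1 + G.coverProb Sr S * δ) ^ ⌊l⌋₊ ≤ Real.exp (δ * max (l * M₀) K) := by
        have h5 : (1 + G.coverProb Sr S * δ) ^ ⌊l⌋₊ ≤ Real.exp (G.coverProb Sr S * δ) ^ ⌊l⌋₊ := by
          gcongr
          rw [add_comm]
          exact Real.add_one_le_exp _
        refine h5.trans ?_
        rw [← Real.exp_nat_mul, Real.exp_le_exp]
        calc (⌊l⌋₊ : ℝ) * (G.coverProb Sr S * δ) = δ * (⌊l⌋₊ * G.coverProb Sr S) := by ring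
          _ ≤ δ * (l * M₀) := by gcongr
          _ ≤ δ * max (l * M₀) K := by gcongr; exact le_max_left _ _
      have hlog := sq_div_le_one_add_mul_log_sub hδ.le
      have hmax : K ≤ max (l * M₀) K := le_max_right _ _
      have hK0 : 0 < K := by
        by_contra hc
        nlinarith
      calc Real.exp (-(Real.log (1 + δ) * ((1 + δ) * max (l * M₀) K))) *
            ((1 + G.coverProb Sr S * δ) ^ ⌊l⌋₊ * (1 + G.coverProb Sr S * δ))
          ≤ Real.exp (-(Real.log (1 + δ) * ((1 + δ) * max (l * M₀) K))) *
            (Real.exp (δ * max (l * M₀) K) * 3) := by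
            gcongr
            linarith
        _ = 3 * Real.exp (-(((1 + δ) * Real.log (1 + δ) - δ) * max (l * M₀) K)) := by
            rw [← mul_assoc, ← Real.exp_add, mul_comm]
            congr 2
            ring
        _ ≤ 3 * Real.exp (-(δ ^ 2 / (2 + δ) * K)) := by
            have := mul_le_mul hlog hmax hK0.le
              (le_trans (by positivity : 0 ≤ δ ^ 2 / (2 + δ)) hlog)
            gcongr
  · push Not at hex
    refine (toOuterMeasure_mono_support (t := ∅) _ fun R hR h => ?_).trans (by simp)
    exact absurd h.2 (not_lt.2 (hex R hR h.1))

/-- Values that are not in the range `(0, OPT]` of useful estimates. -/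
def badEstimates (o : ℝ) : Set ℝ := {x | ¬ (0 < x ∧ x ≤ o)}

/-- Union bound over the iterations and the `k`-sets. Starting from a random list of `m` tuples
keeps the list independent. Passing the test with a set forces coverage at least (1 + δ) λ₃/n, a
threshold that does not depend on `i`, so every iteration costs the same. -/
theorem estimateLoop_bad_le (G : ICNetwork V) (Sr : Finset V) {k : ℕ}
    (sel : List (RTuple V) → Finset V) (hsel : ∀ R, (sel R).card = k) {δ lam : ℝ} (hδ : 0 < δ)
    (hlam : 0 < lam) (hK : 1 < (1 + δ) * (lam / Fintype.card V)) (hopt : 1 ≤ G.opt Sr k)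
    (t i m : ℕ) (hm : m ≤ ⌊lam / ((Fintype.card V : ℝ) / 2 ^ i)⌋₊ + 1) :
    ((G.rTuples Sr m).bind (G.estimateLoop Sr sel δ lam t i)).toOuterMeasure
        (badEstimates (G.opt Sr k)) ≤
      t * ((Fintype.card V).choose k *
        ENNReal.ofReal (3 * Real.exp (-(δ ^ 2 / (2 + δ) * (lam / Fintype.card V))))) := by
  have hn : (0 : ℝ) < Fintype.card V := by exact_mod_cast Fintype.card_pos
  set n : ℝ := ((Fintype.card V : ℕ) : ℝ)
  set c : ℝ≥0∞ := (Fintype.card V).choose k *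
    ENNReal.ofReal (3 * Real.exp (-(δ ^ 2 / (2 + δ) * (lam / n))))
  induction t generalizing i m with
  | zero =>
    have : G.estimateLoop Sr sel δ lam 0 i = fun _ => PMF.pure 1 := by
      funext R
      simp only [estimateLoop]
    rw [this, PMF.bind_const, toOuterMeasure_eq_expect, expect_pure]
    simp [badEstimates, hopt]
  | succ t ih =>
    set x : ℝ := n / 2 ^ i with hx
    have hx0 : 0 < x := by positivity
    set l : ℝ := lam / x with hl
    have hl0 : 0 < l := by positivity
    have hfloor : (⌊l⌋ + 1).toNat = ⌊l⌋₊ + 1 := by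
      have : 0 ≤ ⌊l⌋ := Int.floor_nonneg.2 hl0.le
      rw [← Int.floor_toNat]
      omega
    let g : List (RTuple V) → PMF ℝ := fun R' =>
      if n * (coverage (sel R') R' : ℝ) / l ≥ (1 + δ) * x then
        PMF.pure (n * (coverage (sel R') R' : ℝ) / (l * (1 + δ)))
      else G.estimateLoop Sr sel δ lam t (i + 1) R'
    have hstep : (G.rTuples Sr m).bind (G.estimateLoop Sr sel δ lam (t + 1) i) =
        (G.rTuples Sr (⌊l⌋₊ + 1)).bind g := by
      have : ⌊l⌋₊ + 1 = m + (⌊l⌋₊ + 1 - m) := by omega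
      rw [this, rTuples_add, PMF.bind_bind]
      refine bind_congr_support _ fun R hR => ?_
      rw [PMF.bind_map, ← hfloor, ← G.length_of_mem_support_rTuples Sr hR]
      rfl
    let bad : Set (List (RTuple V)) := {R | ∃ S ∈ Finset.powersetCard k Finset.univ,
      R ∈ {R | (1 + δ) * (lam / n) ≤ (coverage S R : ℝ) ∧
        (1 + δ) * (l * (G.opt Sr k / n)) < coverage S R}}
    have hbad : (G.rTuples Sr (⌊l⌋₊ + 1)).toOuterMeasure bad ≤ c := by
      have := toOuterMeasure_exists_le (G.rTuples Sr (⌊l⌋₊ + 1)) (Finset.powersetCard k Finset.univ)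
        (fun S => {R | (1 + δ) * (lam / n) ≤ (coverage S R : ℝ) ∧
          (1 + δ) * (l * (G.opt Sr k / n)) < coverage S R}) _ fun S hS =>
        G.coverage_overestimate_le Sr S hδ hl0 hK
          (G.coverProb_le_opt_div Sr (Finset.mem_powersetCard.1 hS).2.le)
      rwa [Finset.card_powersetCard, Finset.card_univ] at this
    -- The remaining loop is charged even if the test succeeds. This avoids conditioning on failed
    -- tests, which would destroy independence.
    have hpt : ∀ R, (g R).toOuterMeasure (badEstimates (G.opt Sr k)) ≤
        bad.indicator (fun _ => 1) R +
          (G.estimateLoop Sr sel δ lam t (i + 1) R).toOuterMeasure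
            (badEstimates (G.opt Sr k)) := by
      intro R
      by_cases hR : R ∈ bad
      · rw [Set.indicator_of_mem hR]
        exact (toOuterMeasure_le_one _ _).trans le_self_add
      simp only [g]
      split_ifs with htest
      · rw [toOuterMeasure_eq_expect, expect_pure, Set.indicator_of_notMem]
        · exact zero_le
        rw [badEstimates, Set.mem_ofPred_eq, not_not]
        set F : ℝ := ((coverage (sel R) R : ℕ) : ℝ)
        have hlx : l * x = lam := by rw [hl]; field_simp
        have htest' : (1 + δ) * lam ≤ n * F := by
          rw [ge_iff_le, le_div_iff₀ hl0] at htest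
          rw [← hlx]
          linarith
        refine ⟨div_pos (lt_of_lt_of_le (by positivity) htest') (by positivity), ?_⟩
        by_contra hgt
        rw [not_le, lt_div_iff₀ (by positivity)] at hgt
        refine hR ⟨sel R, Finset.mem_powersetCard.2 ⟨Finset.subset_univ _, hsel R⟩, ?_, ?_⟩
        · rw [← mul_div_assoc, div_le_iff₀ hn]
          linarith
        · rw [← mul_div_assoc, ← mul_div_assoc, div_lt_iff₀ hn]
          linarith
      · exact le_add_self
    have hm' : ⌊l⌋₊ + 1 ≤ ⌊lam / (n / 2 ^ (i + 1))⌋₊ + 1 := by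
      gcongr
      rw [hl, hx, pow_succ]
      gcongr
      have : (0 : ℝ) < 2 ^ i := by positivity
      linarith
    rw [hstep, bind_toOuterMeasure]
    refine (expect_mono _ fun R _ => hpt R).trans ?_
    rw [expect_add, ← toOuterMeasure_eq_expect, ← bind_toOuterMeasure]
    calc _ ≤ c + t * c := add_le_add hbad (ih (i + 1) _ hm')
      _ = _ := by push_cast; ring

theorem natCast_log_le_logb {n : ℕ} (hn : 1 ≤ n) :
    (Nat.log 2 (n - 1) : ℝ) ≤ Real.logb 2 n := by
  have h1 := Real.natLog_le_logb (n - 1) 2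
  rcases Nat.eq_zero_or_pos (n - 1) with h | h
  · rw [h]
    simpa using Real.logb_nonneg one_lt_two (by exact_mod_cast hn)
  · refine h1.trans ?_
    push_cast
    gcongr
    · exact one_lt_two
    · omega

/-- λ₃ is such that a fixed set errs in one iteration with probability at most 3/(N binom(n, k) log₂
n), and there are at most log₂ n iterations. -/
theorem estimate_bad_le (G : ICNetwork V) (Sr : Finset V) {k : ℕ} (hkn : k ≤ Fintype.card V)
    (sel : List (RTuple V) → Finset V) (hsel : ∀ R, (sel R).card = k) {δ N : ℝ} (hδ : 0 < δ)
    (hN : 5 < N) (hopt : 1 ≤ G.opt Sr k) :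
    (G.estimate Sr sel k δ N).toOuterMeasure (badEstimates (G.opt Sr k)) ≤
      ENNReal.ofReal (3 / N) := by
  have hn : (0 : ℝ) < Fintype.card V := by exact_mod_cast Fintype.card_pos
  rcases Nat.eq_zero_or_pos (Nat.log 2 (Fintype.card V - 1)) with h0 | hpos
  · rw [estimate, h0]
    simp only [estimateLoop]
    rw [toOuterMeasure_eq_expect, expect_pure]
    simp [badEstimates, hopt]
  have hlogb := natCast_log_le_logb (n := Fintype.card V) Fintype.card_pos
  have hlogb1 : 1 ≤ Real.logb 2 (Fintype.card V) := le_trans (by exact_mod_cast hpos) hlogb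
  have hC : (1 : ℝ) ≤ (Fintype.card V).choose k := by
    exact_mod_cast Nat.choose_pos hkn
  set n := Fintype.card V
  set Q : ℝ := N * n.choose k * Real.logb 2 n with hQ
  have hNC : N ≤ N * n.choose k := le_mul_of_one_le_right (by linarith) hC
  have hNQ : N ≤ Q := hNC.trans (le_mul_of_one_le_right (by linarith) hlogb1)
  have hQ0 : 0 < Q := by linarith
  -- Here `5 < N` enters, through `e < N ≤ Q`; it yields the threshold condition `hK`.
  have hL : 1 < Real.log Q := by
    rw [Real.lt_log_iff_exp_lt hQ0]
    linarith [Real.exp_one_lt_d9]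
  have hlamn : lambda₃ n k δ N / n = (2 + δ) / δ ^ 2 * Real.log Q := by
    rw [lambda₃, ← hQ]
    field_simp
  have hlam : 0 < lambda₃ n k δ N := by
    rw [lambda₃, ← hQ]
    have : 0 < Real.log Q := by linarith
    positivity
  have hK : 1 < (1 + δ) * (lambda₃ n k δ N / n) := by
    rw [hlamn, ← mul_assoc]
    have : 1 ≤ (1 + δ) * ((2 + δ) / δ ^ 2) := by
      rw [← mul_div_assoc, le_div_iff₀ (by positivity)]
      nlinarith
    nlinarith
  have hmain := G.estimateLoop_bad_le Sr sel hsel hδ hlam hK hopt (Nat.log 2 (n - 1)) 1 0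
    (Nat.zero_le _)
  rw [rTuples, PMF.pure_bind] at hmain
  refine hmain.trans ?_
  have hexp : δ ^ 2 / (2 + δ) * (lambda₃ n k δ N / n) = Real.log Q := by
    rw [hlamn]
    field_simp
  rw [hexp, Real.exp_neg, Real.exp_log hQ0, ← ENNReal.ofReal_natCast, ← ENNReal.ofReal_natCast,
    ← ENNReal.ofReal_mul (Nat.cast_nonneg _), ← ENNReal.ofReal_mul (Nat.cast_nonneg _)]
  refine ENNReal.ofReal_le_ofReal ?_
  calc (Nat.log 2 (n - 1) : ℝ) * (n.choose k * (3 * Q⁻¹))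
      ≤ Real.logb 2 n * (n.choose k * (3 * Q⁻¹)) := by gcongr
    _ = 3 / N := by
      rw [hQ]
      field_simp

/-! ### The main algorithm -/

theorem choose_mul_exp_le {C N a : ℝ} (hC : 0 < C) (hN : 0 < N) (ha : Real.log (N * C) ≤ a) :
    C * Real.exp (-a) ≤ 1 / N := by
  calc C * Real.exp (-a) ≤ C * Real.exp (-Real.log (N * C)) := by gcongr
    _ = 1 / N := by
      rw [Real.exp_neg, Real.exp_log (by positivity)]
      field_simp

theorem select_fail_le (G : ICNetwork V) (Sr : Finset V) {k : ℕ} (hk : 1 ≤ k)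
    (hkn : k ≤ Fintype.card V) (sel : List (RTuple V) → Finset V)
    (hsel : ∀ R, GreedySelects R k (sel R)) {N δ₁ δ₂ o : ℝ} (hN : 1 ≤ N) (hδ₁ : 0 < δ₁)
    (hδ₂ : (1 - 1 / Real.exp 1) * δ₁ < δ₂) (ho : 0 < o) (hopt : o ≤ G.opt Sr k) {m : ℕ}
    (hm₁ : sampleSize₁ (Fintype.card V) N δ₁ o ≤ m)
    (hm₂ : sampleSize₂ (Fintype.card V) k N δ₁ δ₂ o ≤ m) :
    (G.rTuples Sr m).toOuterMeasure
        {R | G.objective Sr (sel R) < (1 - 1 / Real.exp 1 - δ₂) * G.opt Sr k} ≤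
      ENNReal.ofReal (2 / N) := by
  have hn : (0 : ℝ) < Fintype.card V := by exact_mod_cast Fintype.card_pos
  have hC : (1 : ℝ) ≤ (Fintype.card V).choose k := by
    exact_mod_cast Nat.choose_pos hkn
  have hm0 : (0 : ℝ) ≤ m := m.cast_nonneg
  have he : 0 ≤ 1 - 1 / Real.exp 1 := by
    rw [sub_nonneg, div_le_one (Real.exp_pos 1)]
    exact Real.one_le_exp zero_le_one
  obtain ⟨O, hO, hOopt⟩ := G.exists_objective_eq_opt Sr k
  -- The share of the error δ₂ left for the upper tail after the lower tail has used (1 - 1/e) δ₁.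
  set ε : ℝ := δ₂ - (1 - 1 / Real.exp 1) * δ₁ with hε
  have hε0 : 0 < ε := sub_pos.2 hδ₂
  set M : ℝ := G.coverProb Sr O with hM
  have hoptM : G.opt Sr k = Fintype.card V * M := by rw [← hOopt, objective_eq]
  have hMpos : o / Fintype.card V ≤ M := by
    rw [div_le_iff₀ hn, mul_comm, ← hoptM]
    exact hopt
  have hM0 : 0 < M := lt_of_lt_of_le (by positivity) hMpos
  set low : Set (List (RTuple V)) := {R | (coverage O R : ℝ) ≤ (1 - δ₁) * (m * M)} with hlow
  set high : Set (List (RTuple V)) := {R | ∃ S ∈ Finset.powersetCard k Finset.univ,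
    R ∈ {R | m * (G.coverProb Sr S + ε * M) ≤ (coverage S R : ℝ)}}
  -- Outside `low`, a failing selection satisfies m (μ_S + εM) ≤ (1 - 1/e)(1 - δ₁) mM ≤ (1 - 1/e)
  -- F(O) ≤ F(S), which is an upper deviation of the selected set.
  have hsub : {R | G.objective Sr (sel R) < (1 - 1 / Real.exp 1 - δ₂) * G.opt Sr k} ⊆
      low ∪ high := by
    intro R hR
    by_cases hRl : R ∈ low
    · exact Or.inl hRl
    refine Or.inr ⟨sel R, Finset.mem_powersetCard.2 ⟨Finset.subset_univ _, (hsel R).card⟩, ?_⟩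
    rw [hlow, Set.mem_ofPred_eq, not_le] at hRl
    rw [Set.mem_ofPred_eq, objective_eq, hoptM, mul_left_comm] at hR
    have h1 := lt_of_mul_lt_mul_left hR hn.le
    have h2 := (hsel R).coverage_ge hk hO
    have h3 := mul_le_mul_of_nonneg_left hRl.le he
    have h4 := mul_le_mul_of_nonneg_left h1.le hm0
    rw [Set.mem_ofPred_eq]
    refine le_trans ?_ (h3.trans h2)
    rw [hε]
    linarith
  have hPlow : (G.rTuples Sr m).toOuterMeasure low ≤ ENNReal.ofReal (1 / N) := by
    refine (G.coverage_lower_tail Sr O hδ₁.le m).trans (ENNReal.ofReal_le_ofReal ?_)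
    have h := choose_mul_exp_le (C := 1) (N := N) (a := δ₁ ^ 2 * (m * M) / 2) one_pos (by linarith)
      (by
        rw [mul_one]
        rw [sampleSize₁, div_le_iff₀ (by positivity)] at hm₁
        have h1 : (m : ℝ) * (δ₁ ^ 2 * o) ≤ m * (δ₁ ^ 2 * (Fintype.card V * M)) := by
          gcongr
          rw [← hoptM]
          exact hopt
        have h2 : (Fintype.card V : ℝ) * Real.log N ≤
            Fintype.card V * (δ₁ ^ 2 * (m * M) / 2) := by linarith
        exact le_of_mul_le_mul_left h2 hn)
    simpa using h
  have hPhigh : (G.rTuples Sr m).toOuterMeasure high ≤ ENNReal.ofReal (1 / N) := by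
    have hS : ∀ S ∈ Finset.powersetCard k (Finset.univ : Finset V), G.coverProb Sr S ≤ M := by
      intro S hS
      have := G.coverProb_le_opt_div Sr (Finset.mem_powersetCard.1 hS).2.le
      rwa [hoptM, mul_div_cancel_left₀ _ hn.ne'] at this
    refine (toOuterMeasure_exists_le _ _ _ _ fun S hS' =>
      G.coverage_upper_tail Sr S hε0.le (hS S hS') m).trans ?_
    rw [Finset.card_powersetCard, Finset.card_univ, ← ENNReal.ofReal_natCast,
      ← ENNReal.ofReal_mul (Nat.cast_nonneg _)]
    refine ENNReal.ofReal_le_ofReal (choose_mul_exp_le (by linarith) (by linarith) ?_)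
    have hsize : (2 + δ₂ - (1 - 1 / Real.exp 1) * δ₁) = 2 + ε := by rw [hε]; ring
    rw [sampleSize₂, hsize, ← hε, div_le_iff₀ (by positivity)] at hm₂
    have h1 : (m : ℝ) * (ε ^ 2 * o) ≤ m * (ε ^ 2 * (Fintype.card V * M)) := by
      gcongr
      rw [← hoptM]
      exact hopt
    rw [div_mul_eq_mul_div, le_div_iff₀ (by positivity)]
    refine le_of_mul_le_mul_left ?_ hn
    linarith
  refine (toOuterMeasure_mono_support _ fun R _ hR => hsub hR).trans
    ((MeasureTheory.measure_union_le low high).trans ((add_le_add hPlow hPhigh).trans ?_))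
  rw [← ENNReal.ofReal_add (by positivity) (by positivity)]
  refine ENNReal.ofReal_le_ofReal (le_of_eq ?_)
  ring

theorem rbr_fail_le (G : ICNetwork V) (Sr : Finset V) {k : ℕ} (hk : 1 ≤ k)
    (hkn : k ≤ Fintype.card V) {N δ₁ δ₂ δ₃ : ℝ} (hN : 5 < N) (hδ₁ : 0 < δ₁)
    (hδ₂ : (1 - 1 / Real.exp 1) * δ₁ < δ₂) (hδ₃ : 0 < δ₃) (sel : List (RTuple V) → Finset V)
    (hsel : ∀ R, GreedySelects R k (sel R)) :
    (G.rbr Sr sel k N δ₁ δ₂ δ₃).toOuterMeasure {S | S.card ≤ k ∧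
        G.objective Sr S ≥ (1 - 1 / Real.exp 1 - δ₂) * G.opt Sr k}ᶜ ≤ ENNReal.ofReal (5 / N) := by
  have hpre : sel ⁻¹' {S | S.card ≤ k ∧
      G.objective Sr S ≥ (1 - 1 / Real.exp 1 - δ₂) * G.opt Sr k}ᶜ =
      {R | G.objective Sr (sel R) < (1 - 1 / Real.exp 1 - δ₂) * G.opt Sr k} := by
    ext R
    simp [(hsel R).card]
  have h5 : ENNReal.ofReal (5 / N) = ENNReal.ofReal (3 / N) + ENNReal.ofReal (2 / N) := by
    rw [← ENNReal.ofReal_add (by positivity) (by positivity)]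
    congr 1
    ring
  rw [rbr]
  -- If all nodes are rumor seeds, the default estimate 1 exceeds the optimum 0, but then every set
  -- is optimal.
  by_cases hSr : Sr = Finset.univ
  · subst hSr
    obtain ⟨O, -, hO⟩ := G.exists_objective_eq_opt Finset.univ k
    refine (bind_toOuterMeasure_le _ _ _ ∅ 0 fun o _ => ?_).trans (by simp)
    rw [PMF.toOuterMeasure_map_apply, hpre, ← hO]
    simp [objective_univ]
  · obtain ⟨v, hv⟩ : ∃ v, v ∉ Sr := by
      by_contra hc
      push Not at hc
      exact hSr (Finset.eq_univ_iff_forall.2 hc)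
    rw [h5]
    refine (bind_toOuterMeasure_le _ _ _ (badEstimates (G.opt Sr k)) (ENNReal.ofReal (2 / N))
      fun o ho => ?_).trans (add_le_add_left (G.estimate_bad_le Sr hkn sel
        (fun R => (hsel R).card) hδ₃ hN (G.one_le_opt hk hv)) _)
    rw [badEstimates, Set.mem_ofPred_eq, not_not] at ho
    rw [PMF.toOuterMeasure_map_apply, hpre]
    exact G.select_fail_le Sr hk hkn sel hsel (by linarith) hδ₁ hδ₂ ho.1 ho.2
      ((le_max_left _ _).trans (Nat.le_ceil _)) ((le_max_right _ _).trans (Nat.le_ceil _))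

end ICNetwork

end RumorBlocking

theorem mainTheorem1 {V : Type*} [Fintype V] [DecidableEq V] [Nonempty V]
    (G : RumorBlocking.ICNetwork V) (Sr : Finset V)
    (k : ℕ) (hk : 1 ≤ k) (hkn : k ≤ Fintype.card V)
    (N δ₁ δ₂ δ₃ : ℝ) (hN : 0 < N) (hδ₁ : 0 < δ₁)
    (hδ₂ : (1 - 1 / Real.exp 1) * δ₁ < δ₂) (hδ₃ : 0 < δ₃)
    (sel : List (RumorBlocking.RTuple V) → Finset V)
    (hsel : ∀ R, RumorBlocking.GreedySelects R k (sel R)) :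
    1 - 5 / N ≤ ((G.rbr Sr sel k N δ₁ δ₂ δ₃).toOuterMeasure
      {S | S.card ≤ k ∧
        G.objective Sr S ≥ (1 - 1 / Real.exp 1 - δ₂) * G.opt Sr k}).toReal := by
  -- For `N ≤ 5` the claimed probability is not positive.
  rcases le_or_gt N 5 with hN5 | hN5
  · refine le_trans ?_ ENNReal.toReal_nonneg
    rw [sub_nonpos, le_div_iff₀ hN]
    linarith
  have hfail := G.rbr_fail_le Sr hk hkn hN5 hδ₁ hδ₂ hδ₃ sel hsel
  set p := G.rbr Sr sel k N δ₁ δ₂ δ₃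
  set s := {S | S.card ≤ k ∧ G.objective Sr S ≥ (1 - 1 / Real.exp 1 - δ₂) * G.opt Sr k}
  have hne : ∀ t, p.toOuterMeasure t ≠ ⊤ := fun t =>
    ne_top_of_le_ne_top ENNReal.one_ne_top (RumorBlocking.toOuterMeasure_le_one p t)
  have hadd := congrArg ENNReal.toReal (RumorBlocking.toOuterMeasure_add_compl p s)
  rw [ENNReal.toReal_add (hne _) (hne _), ENNReal.toReal_one] at hadd
  have := ENNReal.toReal_le_of_le_ofReal (by positivity) hfail
  linarith
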